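/- A map $\gamma:[0,1]\to X$ into a metric space $(X,d)$ is a *geodesic from $x$ to $y$* if $\gamma(0)=x$, $\gamma(1)=y$ and $d(\gamma(s),\gamma(t))=|s-t|\,d(x,y)$ for all $s,t\in[0,1]$. A metric space is *geodesic* if any two of its points are joined by a geodesic, and a geodesic space $(X,d)$ is a $\mathrm{CAT}(0)$ *space* if for every geodesic triangle $\triangle$ in $X$ and all $x,y\in\triangle$ one has $d(x,y)\le\|\overline{x}-\overline{y}\|$, where $\overline{x},\overline{y}$ are the comparison points of $x,y$ in a comparison triangle of $\triangle$ in the Euclidean plane $\mathbb{R}^2$. A metric space is *proper* if all its bounded closed subsets are compact. Let $\mathscr{PM}$ be the set of pointed isometry classes of pointed proper metric spaces $(X,d,a)$. For $t\in(0,\infty)$ and pointed metric spaces $(X,d,a)$, $(Y,e,b)$, a metric $h$ on the disjoint union $X\sqcup Y$ is *$(t;a,b)$-admissible* if $h|_{X^2}=d$, $h|_{Y^2}=e$, $h(a,b)<t$, every $z\in X\sqcup Y$ with $h(z,a)\le t^{-1}$ satisfies $h(z,y)<t$ for some $y\in Y$, and every $z\in X\sqcup Y$ with $h(z,b)\le t^{-1}$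 satisfies $h(z,x)<t$ for some $x\in X$. The *pointed Gromov–Hausdorff distance* on $\mathscr{PM}$ is the metric $$\rho\big((X,d,a),(Y,e,b)\big)=\min\Big\{\inf\{t\in(0,\infty) : \text{there is a }(t;a,b)\text{-admissible metric on }X\sqcup Y\},\ \tfrac12\Big\}.$$ Let $\mathscr{PZ}\subseteq\mathscr{PM}$ be the subset of the classes of $\mathrm{CAT}(0)$ spaces, with the metric $\rho$. **Theorem 1.4.** Let $n\ge 1$ be an integer, let $H$ be a compact metrizable space, and let $v_1,\dots,v_{n+1}$ be $n+1$ distinct points of $H$. Let $(X_i,d_i,a_i)$, $i=1,\dots,n+1$, be elements of $\mathscr{PZ}$ with $\rho\big((X_i,d_i,a_i),(X_j,d_j,a_j)\big)>0$ for all distinct $i,j$. Then there exists a topological embedding $\Phi:H\to\mathscr{PZ}$ such that $\Phi(v_i)=(X_i,d_i,a_i)$ for all $i=1,\dots,n+1$. -/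

import Mathlib

open Filter Topology

universe u v

/-! ### Geodesic spaces and `CAT(0)` spaces -/

section CAT

variable {X : Type u} [MetricSpace X]

/-- `γ : [0, 1] → X` is a geodesic from `x` to `y`. -/
structure IsGeodesicFromTo (γ : unitInterval → X) (x y : X) : Prop where
  map_zero : γ 0 = x
  map_one : γ 1 = y
  dist_map : ∀ s t : unitInterval, dist (γ s) (γ t) = |(s : ℝ) - (t : ℝ)| * dist x y

/-- A geodesic space: any two points are joined by a geodesic. -/
def IsGeodesicMetricSpace (X : Type u) [MetricSpace X] : Prop :=
  ∀ x y : X, ∃ γ : unitInterval → X, IsGeodesicFromTo γ x y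

/-- A geodesic triangle in `X`, with vertices `p 0`, `p 1`, `p 2`; the `i`-th side is a geodesic
from `p i` to `p (i + 1)`, where indices are taken modulo `3`. -/
structure IsGeodesicTriangle (p : Fin 3 → X) (side : Fin 3 → unitInterval → X) : Prop where
  geodesic : ∀ i, IsGeodesicFromTo (side i) (p i) (p (i + 1))

/-- `q` is the triple of vertices of a comparison triangle in the Euclidean plane for the
triangle with vertices `p`. -/
def IsComparisonTriangle (p : Fin 3 → X) (q : Fin 3 → EuclideanSpace ℝ (Fin 2)) : Prop :=
  ∀ i j, dist (q i) (q j) = dist (p i) (p j)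

/-- A `CAT(0)` space: a geodesic space all of whose geodesic triangles are at least as thin as
their comparison triangles. The comparison point of the point `side i s` of the `i`-th side is the
point of the segment `[q i, q (i + 1)]` that divides it in the same ratio `s`. -/
structure IsCATZero (X : Type u) [MetricSpace X] : Prop where
  geodesic : IsGeodesicMetricSpace X
  thin : ∀ (p : Fin 3 → X) (side : Fin 3 → unitInterval → X), IsGeodesicTriangle p side →
    ∀ q : Fin 3 → EuclideanSpace ℝ (Fin 2), IsComparisonTriangle p q →
    ∀ (i j : Fin 3) (s t : unitInterval),
      dist (side i s) (side j t) ≤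
        dist (AffineMap.lineMap (q i) (q (i + 1)) (s : ℝ))
          (AffineMap.lineMap (q j) (q (j + 1)) (t : ℝ))

end CAT

/-! ### Admissible metrics on a disjoint union -/

section Admissible

variable {X Y Z : Type u} [MetricSpace X] [MetricSpace Y] [MetricSpace Z]

/-- `h` is a `(t; a, b)`-admissible metric on the disjoint union `X ⊕ Y`: it is a metric extending
those of `X` and `Y`, with `h (a, b) < t`, such that the closed `h`-ball of radius `t⁻¹` about
`a` lies in the open `t`-neighbourhood of `Y`, and the closed `h`-ball of radius `t⁻¹` about `b`
lies in the open `t`-neighbourhood of `X`. -/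
structure IsAdmissibleMetric (t : ℝ) (a : X) (b : Y) (h : X ⊕ Y → X ⊕ Y → ℝ) : Prop where
  eq_zero_iff : ∀ z w, h z w = 0 ↔ z = w
  symm : ∀ z w, h z w = h w z
  triangle : ∀ z w k, h z k ≤ h z w + h w k
  restrict_left : ∀ x x' : X, h (Sum.inl x) (Sum.inl x') = dist x x'
  restrict_right : ∀ y y' : Y, h (Sum.inr y) (Sum.inr y') = dist y y'
  base_lt : h (Sum.inl a) (Sum.inr b) < t
  ball_left : {z | h z (Sum.inl a) ≤ t⁻¹} ⊆ {z | ∃ y : Y, h z (Sum.inr y) < t}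
  ball_right : {z | h z (Sum.inr b) ≤ t⁻¹} ⊆ {z | ∃ x : X, h z (Sum.inl x) < t}

/-- Auxiliary, for the proofs of the metric axioms below: `f x y` are the distances between the
points of `X` and those of `Y` in an admissible metric. -/
structure IsCross (t : ℝ) (a : X) (b : Y) (f : X → Y → ℝ) : Prop where
  pos : ∀ x y, 0 < f x y
  le_left : ∀ x x' y, f x y ≤ dist x x' + f x' y
  le_right : ∀ x y y', f x y ≤ f x y' + dist y' y
  dist_left : ∀ x x' y, dist x x' ≤ f x y + f x' y
  dist_right : ∀ x y y', dist y y' ≤ f x y + f x y'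
  base_lt : f a b < t
  ball_left : ∀ x, dist x a ≤ t⁻¹ → ∃ y, f x y < t
  ball_right : ∀ y, dist y b ≤ t⁻¹ → ∃ x, f x y < t

theorem IsCross.swap {t : ℝ} {a : X} {b : Y} {f : X → Y → ℝ} (hf : IsCross t a b f) :
    IsCross t b a (fun y x => f x y) where
  pos y x := hf.pos x y
  le_left y y' x := by
    have := hf.le_right x y y'
    rw [dist_comm] at this; linarith
  le_right y x x' := by
    have := hf.le_left x x' y
    rw [dist_comm] at this; linarith
  dist_left y y' x := hf.dist_right x y y'
  dist_right y x x' := hf.dist_left x x' y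
  base_lt := hf.base_lt
  ball_left := hf.ball_right
  ball_right := hf.ball_left

theorem IsCross.t_pos {t : ℝ} {a : X} {b : Y} {f : X → Y → ℝ} (hf : IsCross t a b f) : 0 < t :=
  (hf.pos a b).trans hf.base_lt

theorem IsCross.mono {t t' : ℝ} {a : X} {b : Y} {f : X → Y → ℝ} (hf : IsCross t a b f)
    (h : t ≤ t') : IsCross t' a b f where
  pos := hf.pos
  le_left := hf.le_left
  le_right := hf.le_right
  dist_left := hf.dist_left
  dist_right := hf.dist_right
  base_lt := hf.base_lt.trans_le h
  ball_left x hx := by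
    obtain ⟨y, hy⟩ := hf.ball_left x (hx.trans (inv_anti₀ hf.t_pos h))
    exact ⟨y, hy.trans_le h⟩
  ball_right y hy := by
    obtain ⟨x, hx⟩ := hf.ball_right y (hy.trans (inv_anti₀ hf.t_pos h))
    exact ⟨x, hx.trans_le h⟩

theorem IsAdmissibleMetric.isCross {t : ℝ} {a : X} {b : Y} {h : X ⊕ Y → X ⊕ Y → ℝ}
    (hh : IsAdmissibleMetric t a b h) : IsCross t a b (fun x y => h (Sum.inl x) (Sum.inr y)) where
  pos x y := by
    have h1 := hh.triangle (Sum.inl x) (Sum.inr y) (Sum.inl x)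
    rw [hh.symm (Sum.inr y), (hh.eq_zero_iff _ _).2 rfl] at h1
    have h2 : h (Sum.inl x) (Sum.inr y) ≠ 0 := fun h0 => by simpa using (hh.eq_zero_iff _ _).1 h0
    exact lt_of_le_of_ne (by linarith) h2.symm
  le_left x x' y := by
    rw [← hh.restrict_left]; exact hh.triangle _ _ _
  le_right x y y' := by
    rw [← hh.restrict_right]; exact hh.triangle _ _ _
  dist_left x x' y := by
    rw [← hh.restrict_left, hh.symm (Sum.inl x') (Sum.inr y)]; exact hh.triangle _ _ _
  dist_right x y y' := by
    rw [← hh.restrict_right, hh.symm (Sum.inl x) (Sum.inr y)]; exact hh.triangle _ _ _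
  base_lt := hh.base_lt
  ball_left x hx := by
    have h1 : h (Sum.inl x) (Sum.inl a) ≤ t⁻¹ := by rwa [hh.restrict_left]
    exact hh.ball_left h1
  ball_right y hy := by
    have h1 : h (Sum.inr y) (Sum.inr b) ≤ t⁻¹ := by rwa [hh.restrict_right]
    obtain ⟨x, hx⟩ := hh.ball_right h1
    exact ⟨x, by rwa [hh.symm]⟩

theorem IsCross.exists_admissible {t : ℝ} {a : X} {b : Y} {f : X → Y → ℝ}
    (hf : IsCross t a b f) : ∃ h, IsAdmissibleMetric t a b h := by
  let h : X ⊕ Y → X ⊕ Y → ℝ := fun z w => match z, w with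
    | Sum.inl x, Sum.inl x' => dist x x'
    | Sum.inl x, Sum.inr y => f x y
    | Sum.inr y, Sum.inl x => f x y
    | Sum.inr y, Sum.inr y' => dist y y'
  refine ⟨h, ?_, ?_, ?_, fun _ _ => rfl, fun _ _ => rfl, hf.base_lt, ?_, ?_⟩
  · rintro (x | y) (x' | y')
    · simp [h]
    · simpa [h] using (hf.pos x y').ne'
    · simpa [h] using (hf.pos x' y).ne'
    · simp [h]
  · rintro (x | y) (x' | y')
    · exact dist_comm _ _
    · rfl
    · rfl
    · exact dist_comm _ _
  · rintro (x | y) (x' | y') (x'' | y'')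
    · exact dist_triangle _ _ _
    · exact hf.le_left _ _ _
    · exact hf.dist_left _ _ _
    · exact hf.le_right _ _ _
    · have := hf.le_left x'' x' y
      rw [dist_comm] at this
      change f x'' y ≤ f x' y + dist x' x''
      linarith
    · exact hf.dist_right _ _ _
    · have := hf.le_right x'' y y'
      rw [dist_comm] at this
      change f x'' y ≤ dist y y' + f x'' y'
      linarith
    · exact dist_triangle _ _ _
  · rintro (x | y) hx
    · exact hf.ball_left x hx
    · exact ⟨y, by simpa [h] using hf.t_pos⟩
  · rintro (x | y) hy
    · exact ⟨x, by simpa [h] using hf.t_pos⟩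
    · exact hf.ball_right y hy

/-- Composition of cross distances, with a positive defect `η` added. -/
theorem IsCross.comp {t₁ t₂ η : ℝ} {a : X} {b : Y} {c : Z} {f : X → Y → ℝ} {g : Y → Z → ℝ}
    (hf : IsCross t₁ a b f) (hg : IsCross t₂ b c g) (hη : 0 < η) (hsum : t₁ + t₂ + η ≤ 1 / 2) :
    IsCross (t₁ + t₂ + η) a c (fun x z => (⨅ y, (f x y + g y z)) + η) := by
  have h₁ := hf.t_pos
  have h₂ := hg.t_pos
  have : Nonempty Y := ⟨b⟩
  have bdd : ∀ x z, BddBelow (Set.range fun y => f x y + g y z) := fun x z =>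
    ⟨0, by rintro _ ⟨y, rfl⟩; exact (add_pos (hf.pos _ _) (hg.pos _ _)).le⟩
  have le : ∀ x y z, (⨅ y, (f x y + g y z)) ≤ f x y + g y z := fun x y z => ciInf_le (bdd x z) y
  have key : ∀ s₁ s₂ : ℝ, 0 < s₁ → 0 < s₂ → s₁ + s₂ + η ≤ 1 / 2 →
      (s₁ + s₂ + η)⁻¹ + 2 * s₁ ≤ s₂⁻¹ := by
    intro s₁ s₂ p₁ p₂ hs
    set s := s₁ + s₂ + η with hsdef
    have hs0 : 0 < s := by positivity
    have e : s₂⁻¹ - s⁻¹ = (s₁ + η) * (s₂⁻¹ * s⁻¹) := by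
      field_simp; rw [hsdef]; ring
    have i1 : 2 ≤ s₂⁻¹ := by
      rw [le_inv_comm₀ (by norm_num) p₂]; linarith
    have i2 : 2 ≤ s⁻¹ := by
      rw [le_inv_comm₀ (by norm_num) hs0]; linarith
    nlinarith [mul_le_mul i1 i2 (by norm_num) (by linarith)]
  refine ⟨?_, ?_, ?_, ?_, ?_, ?_, ?_, ?_⟩
  · intro x z
    have : 0 ≤ ⨅ y, (f x y + g y z) :=
      le_ciInf fun y => (add_pos (hf.pos _ _) (hg.pos _ _)).le
    linarith
  · intro x x' z
    have : (⨅ y, (f x y + g y z)) - dist x x' ≤ ⨅ y, (f x' y + g y z) := le_ciInf fun y => by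
      linarith [le x y z, hf.le_left x x' y]
    linarith
  · intro x z z'
    have : (⨅ y, (f x y + g y z)) - dist z' z ≤ ⨅ y, (f x y + g y z') := le_ciInf fun y => by
      linarith [le x y z, hg.le_right y z z']
    linarith
  · intro x x' z
    have : dist x x' - (⨅ y, (f x y + g y z)) ≤ ⨅ y, (f x' y + g y z) := le_ciInf fun y' => by
      have : dist x x' - (f x' y' + g y' z) ≤ ⨅ y, (f x y + g y z) := le_ciInf fun y => by
        linarith [hf.dist_left x x' y', hf.le_right x y' y, hg.dist_left y y' z]
      linarith
    linarith
  · intro x z z'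
    have : dist z z' - (⨅ y, (f x y + g y z)) ≤ ⨅ y, (f x y + g y z') := le_ciInf fun y' => by
      have : dist z z' - (f x y' + g y' z') ≤ ⨅ y, (f x y + g y z) := le_ciInf fun y => by
        have := hg.le_left y' y z
        rw [dist_comm] at this
        linarith [hg.dist_right y' z z', hf.dist_right x y y']
      linarith
    linarith
  · linarith [le a b c, hf.base_lt, hg.base_lt]
  · intro x hx
    have k := key t₁ t₂ h₁ h₂ hsum
    obtain ⟨y, hy⟩ := hf.ball_left x (hx.trans (inv_anti₀ h₁ (by linarith)))
    obtain ⟨z, hz⟩ := hg.ball_left y (by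
      linarith [hf.dist_right x y b, hf.le_left x a b, hf.base_lt])
    exact ⟨z, by linarith [le x y z]⟩
  · intro z hz
    have k := key t₂ t₁ h₂ h₁ (by linarith)
    rw [add_comm t₂ t₁] at k
    obtain ⟨y, hy⟩ := hg.ball_right z (hz.trans (inv_anti₀ h₂ (by linarith)))
    have h3 := hg.le_right b z c
    rw [dist_comm] at h3
    obtain ⟨x, hx⟩ := hf.ball_right y (by
      linarith [hg.dist_left y b z, hg.base_lt])
    exact ⟨x, by linarith [le x y z]⟩

theorem isCross_of_isometryEquiv {t : ℝ} (ht : 0 < t) {a : X} {b : Y} (e : X ≃ᵢ Y)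
    (he : e a = b) : IsCross t a b (fun x y => dist (e x) y + t / 2) where
  pos x y := by positivity
  le_left x x' y := by
    rw [← e.dist_eq x x']; linarith [dist_triangle (e x) (e x') y]
  le_right x y y' := by linarith [dist_triangle (e x) y' y]
  dist_left x x' y := by
    rw [← e.dist_eq x x']; linarith [dist_triangle_right (e x) (e x') y]
  dist_right x y y' := by linarith [dist_triangle_left y y' (e x)]
  base_lt := by rw [he, dist_self]; linarith
  ball_left x _ := ⟨e x, by rw [dist_self]; linarith⟩
  ball_right y _ := ⟨e.symm y, by rw [e.apply_symm_apply, dist_self]; linarith⟩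

theorem isCross_two (a : X) (b : Y) :
    IsCross 2 a b (fun x y => dist x a + 1 + dist b y) where
  pos x y := by positivity
  le_left x x' y := by linarith [dist_triangle x x' a]
  le_right x y y' := by linarith [dist_triangle b y' y]
  dist_left x x' y := by
    linarith [dist_triangle_right x x' a, dist_nonneg (x := b) (y := y)]
  dist_right x y y' := by
    linarith [dist_triangle_left y y' b, dist_nonneg (x := x) (y := a)]
  base_lt := by simp
  ball_left x hx := ⟨b, by rw [dist_self]; norm_num at hx; linarith⟩
  ball_right y hy := ⟨a, by rw [dist_self, dist_comm]; norm_num at hy; linarith⟩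

end Admissible

/-! ### The space of pointed proper metric spaces -/

/-- Pointed proper metric spaces. -/
structure PointedProperSpace : Type (u + 1) where
  carrier : Type u
  [metricSpace : MetricSpace carrier]
  [properSpace : ProperSpace carrier]
  base : carrier

attribute [instance] PointedProperSpace.metricSpace PointedProperSpace.properSpace

namespace PointedProperSpace

/-- Pointed isometry: there is an isometric bijection that maps the base point to the base
point. -/
instance pointedIsometrySetoid : Setoid PointedProperSpace.{u} where
  r X Y := ∃ e : X.carrier ≃ᵢ Y.carrier, e X.base = Y.base
  iseqv :=
    { refl := fun X => ⟨IsometryEquiv.refl _, rfl⟩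
      symm := fun ⟨e, he⟩ => ⟨e.symm, by rw [← he, e.symm_apply_apply]⟩
      trans := fun ⟨e, he⟩ ⟨e', he'⟩ => ⟨e.trans e', by
        change e' (e _) = _
        rw [he, he']⟩ }

/-- The infimum of all `t > 0` for which a `(t; a, b)`-admissible metric exists. -/
noncomputable def preDist (X Y : PointedProperSpace.{u}) : ℝ :=
  sInf {t : ℝ | 0 < t ∧ ∃ h, IsAdmissibleMetric t X.base Y.base h}

/-- The pointed Gromov--Hausdorff distance between pointed proper metric spaces. -/
noncomputable def pghDist (X Y : PointedProperSpace.{u}) : ℝ :=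
  min (preDist X Y) (1 / 2)

theorem preDist_le {X Y : PointedProperSpace.{u}} {t : ℝ} {f : X.carrier → Y.carrier → ℝ}
    (hf : IsCross t X.base Y.base f) : preDist X Y ≤ t := by
  refine csInf_le ⟨0, ?_⟩ ⟨hf.t_pos, hf.exists_admissible⟩
  rintro s ⟨hs, _⟩
  exact hs.le

theorem exists_isCross {X Y : PointedProperSpace.{u}} {t : ℝ} (h : pghDist X Y < t)
    (ht : t ≤ 1 / 2) : ∃ f, IsCross t X.base Y.base f := by
  have h' : preDist X Y < t := by
    rcases min_lt_iff.1 h with h | h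
    · exact h
    · linarith
  have hne : {t : ℝ | 0 < t ∧ ∃ h, IsAdmissibleMetric t X.base Y.base h}.Nonempty :=
    ⟨2, two_pos, (isCross_two X.base Y.base).exists_admissible⟩
  obtain ⟨s, ⟨_, m, hm⟩, hst⟩ := exists_lt_of_csInf_lt hne h'
  exact ⟨_, hm.isCross.mono hst.le⟩

theorem pghDist_nonneg (X Y : PointedProperSpace.{u}) : 0 ≤ pghDist X Y :=
  le_min (Real.sInf_nonneg fun _ h => h.1.le) (by norm_num)

theorem pghDist_eq_zero_of_equiv {X Y : PointedProperSpace.{u}} (h : X ≈ Y) :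
    pghDist X Y = 0 := by
  obtain ⟨e, he⟩ := h
  refine le_antisymm (le_of_forall_pos_le_add fun ε hε => ?_) (pghDist_nonneg X Y)
  rw [zero_add]
  exact (min_le_left _ _).trans (preDist_le (isCross_of_isometryEquiv hε e he))

theorem pghDist_comm (X Y : PointedProperSpace.{u}) : pghDist X Y = pghDist Y X := by
  have key : ∀ X Y : PointedProperSpace.{u}, preDist X Y ≤ preDist Y X := fun X Y =>
    le_csInf ⟨2, two_pos, (isCross_two Y.base X.base).exists_admissible⟩
      fun t ⟨_, m, hm⟩ => preDist_le hm.isCross.swap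
  rw [pghDist, pghDist, le_antisymm (key X Y) (key Y X)]

theorem pghDist_triangle (X Y Z : PointedProperSpace.{u}) :
    pghDist X Z ≤ pghDist X Y + pghDist Y Z := by
  by_contra! hlt
  have h0 := pghDist_nonneg X Y
  have h0' := pghDist_nonneg Y Z
  have hle : pghDist X Z ≤ 1 / 2 := min_le_right _ _
  obtain ⟨δ, hδ⟩ : ∃ δ, δ = (pghDist X Z - pghDist X Y - pghDist Y Z) / 4 := ⟨_, rfl⟩
  have hδ0 : 0 < δ := by rw [hδ]; linarith
  obtain ⟨f, hf⟩ := exists_isCross (X := X) (Y := Y) (t := pghDist X Y + δ) (by linarith)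
    (by linarith)
  obtain ⟨g, hg⟩ := exists_isCross (X := Y) (Y := Z) (t := pghDist Y Z + δ) (by linarith)
    (by linarith)
  have h1 := preDist_le (hf.comp hg hδ0 (by linarith))
  have h2 : pghDist X Z ≤ preDist X Z := min_le_left _ _
  linarith

/-- Limits of almost isometric correspondences exist, by properness. -/
theorem exists_limit {X Y : PointedProperSpace.{u}} {t : ℕ → ℝ}
    {f : ℕ → X.carrier → Y.carrier → ℝ} (hf : ∀ n, IsCross (t n) X.base Y.base (f n))
    (ht : Tendsto t atTop (𝓝 0)) (x : X.carrier) :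
    ∃ y, Tendsto (fun n => f n x y) (hyperfilter ℕ) (𝓝 0) := by
  have hle : (hyperfilter ℕ : Filter ℕ) ≤ atTop := Nat.hyperfilter_le_atTop
  have hinv : Tendsto (fun n => (t n)⁻¹) atTop atTop :=
    tendsto_inv_nhdsGT_zero.comp
      (tendsto_nhdsWithin_iff.2 ⟨ht, Eventually.of_forall fun n => (hf n).t_pos⟩)
  have hex : ∀ n, ∃ y, dist x X.base ≤ (t n)⁻¹ → f n x y < t n := fun n => by
    by_cases h : dist x X.base ≤ (t n)⁻¹
    · obtain ⟨y, hy⟩ := (hf n).ball_left x h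
      exact ⟨y, fun _ => hy⟩
    · exact ⟨Y.base, fun h' => absurd h' h⟩
  choose y hy using hex
  have hev : ∀ᶠ n in (hyperfilter ℕ : Filter ℕ), f n x (y n) < t n :=
    hle ((hinv.eventually_ge_atTop (dist x X.base)).mono fun n hn => hy n hn)
  have hbd : ∀ᶠ n in (hyperfilter ℕ : Filter ℕ),
      y n ∈ Metric.closedBall Y.base (dist x X.base + 2) := by
    filter_upwards [hev, hle (ht.eventually_lt_const one_pos)] with n h1 h2
    rw [Metric.mem_closedBall]
    linarith [(hf n).dist_right x (y n) Y.base, (hf n).le_left x X.base Y.base, (hf n).base_lt]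
  obtain ⟨z, _, hz⟩ := (isCompact_closedBall Y.base (dist x X.base + 2)).ultrafilter_le_nhds
    ((hyperfilter ℕ).map y) (by rw [le_principal_iff]; exact hbd)
  have hz' : Tendsto y (hyperfilter ℕ) (𝓝 z) := hz
  have hd := (ht.mono_left hle).add (tendsto_iff_dist_tendsto_zero.1 hz')
  rw [add_zero] at hd
  refine ⟨z, squeeze_zero' (Eventually.of_forall fun n => ((hf n).pos _ _).le) ?_ hd⟩
  filter_upwards [hev] with n hn
  linarith [(hf n).le_right x z (y n)]

theorem equiv_of_pghDist_eq_zero {X Y : PointedProperSpace.{u}} (h : pghDist X Y = 0) :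
    X ≈ Y := by
  have hex : ∀ n : ℕ, ∃ f, IsCross (1 / ((n : ℝ) + 2)) X.base Y.base f := fun n =>
    exists_isCross (by rw [h]; positivity)
      (by gcongr; linarith [(Nat.cast_nonneg n : (0 : ℝ) ≤ n)])
  choose f hf using hex
  have ht : Tendsto (fun n : ℕ => 1 / ((n : ℝ) + 2)) atTop (𝓝 0) := by
    simp_rw [one_div]
    exact tendsto_inv_atTop_zero.comp
      (tendsto_atTop_add_const_right _ _ tendsto_natCast_atTop_atTop)
  choose F hF using exists_limit hf ht
  choose G hG using exists_limit (fun n => (hf n).swap) ht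
  have key : ∀ x x' y y', Tendsto (fun n => f n x y) (hyperfilter ℕ) (𝓝 0) →
      Tendsto (fun n => f n x' y') (hyperfilter ℕ) (𝓝 0) → dist x x' = dist y y' := by
    intro x x' y y' h1 h2
    have h3 := h1.add h2
    rw [add_zero] at h3
    refine le_antisymm ?_ ?_
    · have h4 := h3.add_const (dist y y')
      rw [zero_add] at h4
      refine ge_of_tendsto' h4 fun n => ?_
      have := (hf n).le_right x' y y'
      rw [dist_comm] at this
      linarith [(hf n).dist_left x x' y]
    · have h4 := h3.add_const (dist x x')
      rw [zero_add] at h4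
      refine ge_of_tendsto' h4 fun n => ?_
      linarith [(hf n).dist_right x y y', (hf n).le_left x x' y']
  have hbase : Tendsto (fun n => f n X.base Y.base) (hyperfilter ℕ) (𝓝 0) :=
    squeeze_zero (fun n => ((hf n).pos _ _).le) (fun n => (hf n).base_lt.le)
      (ht.mono_left Nat.hyperfilter_le_atTop)
  refine ⟨{ toFun := F, invFun := G, left_inv := ?_, right_inv := ?_, isometry_toFun := ?_ }, ?_⟩
  · intro x
    exact dist_eq_zero.1 ((key _ _ _ _ (hG (F x)) (hF x)).trans (dist_self _))
  · intro y
    exact dist_eq_zero.1 ((key _ _ _ _ (hF (G y)) (hG y)).symm.trans (dist_self _))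
  · exact Isometry.of_dist_eq fun x x' => (key _ _ _ _ (hF x) (hF x')).symm
  · exact dist_eq_zero.1 ((key _ _ _ _ (hF X.base) hbase).symm.trans (dist_self _))

end PointedProperSpace

/-- The space of all pointed isometry classes of pointed proper metric spaces. -/
def PointedGHSpace : Type (u + 1) :=
  Quotient PointedProperSpace.pointedIsometrySetoid.{u}

namespace PointedGHSpace

/-- The pointed isometry class of a pointed proper metric space. -/
def mk (X : PointedProperSpace.{u}) : PointedGHSpace.{u} :=
  Quotient.mk _ X

open PointedProperSpace in
/-- The pointed Gromov--Hausdorff distance makes the space of pointed isometry classes of pointed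
proper metric spaces a metric space. -/
noncomputable instance : MetricSpace PointedGHSpace.{u} where
  dist := Quotient.lift₂ pghDist (by
    intro X Y X' Y' hX hY
    have h1 := pghDist_eq_zero_of_equiv hX
    have h2 := pghDist_eq_zero_of_equiv hY
    refine le_antisymm ?_ ?_
    · linarith [pghDist_triangle X X' Y, pghDist_triangle X' Y' Y, pghDist_comm Y Y']
    · linarith [pghDist_triangle X' X Y', pghDist_triangle X Y Y', pghDist_comm X X'])
  dist_self := by
    rintro ⟨X⟩; exact pghDist_eq_zero_of_equiv (Setoid.refl X)
  dist_comm := by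
    rintro ⟨X⟩ ⟨Y⟩; exact pghDist_comm X Y
  dist_triangle := by
    rintro ⟨X⟩ ⟨Y⟩ ⟨Z⟩; exact pghDist_triangle X Y Z
  eq_of_dist_eq_zero := by
    rintro ⟨X⟩ ⟨Y⟩ h; exact Quotient.sound (equiv_of_pghDist_eq_zero h)

/-- The distance of two classes is the pointed Gromov--Hausdorff distance of representatives. -/
theorem dist_mk (X Y : PointedProperSpace.{u}) :
    dist (mk X) (mk Y) = PointedProperSpace.pghDist X Y :=
  rfl

/-- The set of all `CAT(0)` spaces in the space of pointed proper metric spaces. -/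
def catZero : Set PointedGHSpace.{u} :=
  {c | ∃ X : PointedProperSpace.{u}, IsCATZero X.carrier ∧ mk X = c}

end PointedGHSpace

/-!
The embedding sends a point `x` of `H` to a bouquet: closed balls about the base points of the given
spaces `X j`, together with countably many segments, all glued at their base points.

* The radius of the ball in `X j` is a continuous function of `x` with values in `[0, ∞]`, which is
  `∞` exactly at `p j` and `0` at the other points `p i`. The segments have length
  `ℓ k = min (dist (x, range p)) (3⁻ᵏ * (1 + c k x))`, where the functions `c k` take values in
  `[0, 1]` and every tail of the sequence `c` separates the points of `H`. So at `p j` nothing but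
  `X j` is left.
* A bouquet is `CAT(0)` since the inequality of Bruhat and Tits, to which `CAT(0)` is equivalent
  (`IsCATZero.satisfiesBruhatTits`, `SatisfiesBruhatTits.isCATZero`), passes to bouquets and to balls
  (`Bouquet.satisfiesBruhatTits_trunc`). It is proper since the lengths of the segments tend to `0`
  (`Bouquet.properSpace_trunc`).
* The class of the bouquet depends continuously on the radii (`continuous_mk_bouquet`): in a geodesic
  space, concentric balls whose radii differ by little are close, and what happens far away from the
  base point does not matter.
* Injectivity is where the segments are used. The number of points at distance `s` from the base
  point with pairwise distances `2 * s` is a pointed isometry invariant. The contribution of the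
  spaces `X j` to this number is bounded by covering numbers of their balls, whatever the truncation
  is. So if the segment of length `ℓ k` is repeated `m k` times, with `m k` above these covering
  numbers, then the invariant recovers `ℓ k` (`exists_multiplicities`). Outside the range of `p` this
  gives `c k x` for all large `k`, hence `x`; on the range of `p` all lengths vanish, and the
  given spaces are pairwise distinct.

A continuous injection of a compact space into a metric space is an embedding.
-/

/-! ### The Bruhat--Tits inequality -/

section BruhatTits

/-- The inequality of Bruhat and Tits: for all `x`, `y` and `t ∈ [0, 1]` there is a point `m` that
satisfies, for every `z`, the inequality which in the Euclidean plane is the equality of Stewart's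
theorem for the point dividing `[x, y]` in the ratio `t`. No geodesic is mentioned: the inequality
determines `m` and forces it to lie on a geodesic. -/
def SatisfiesBruhatTits (X : Type*) [MetricSpace X] : Prop :=
  ∀ (x y : X) (t : ℝ), 0 ≤ t → t ≤ 1 → ∃ m, ∀ z,
    dist z m ^ 2 ≤ (1 - t) * dist z x ^ 2 + t * dist z y ^ 2 - t * (1 - t) * dist x y ^ 2

variable {X : Type u} [MetricSpace X]

/-- Stewart's theorem. -/
theorem dist_lineMap_sq {E : Type*} [NormedAddCommGroup E] [InnerProductSpace ℝ E]
    (x y z : E) (t : ℝ) :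
    dist z (AffineMap.lineMap x y t) ^ 2 =
      (1 - t) * dist z x ^ 2 + t * dist z y ^ 2 - t * (1 - t) * dist x y ^ 2 := by
  have h1 : z - AffineMap.lineMap x y t = (1 - t) • (z - x) + t • (z - y) := by
    rw [AffineMap.lineMap_apply_module]; module
  have h2 : x - y = (z - y) - (z - x) := by abel
  rw [dist_eq_norm, dist_eq_norm, dist_eq_norm, dist_eq_norm, h1, h2, norm_add_sq_real,
    norm_sub_sq_real (z - y) (z - x), norm_smul, norm_smul, mul_pow, mul_pow, Real.norm_eq_abs,
    Real.norm_eq_abs,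
    sq_abs, sq_abs, real_inner_smul_left, real_inner_smul_right, real_inner_comm (z - x)]
  ring

/-- Comparison triangles exist. -/
theorem exists_comparison (x y z : X) : ∃ a b c : EuclideanSpace ℝ (Fin 2),
    dist a b = dist x y ∧ dist b c = dist y z ∧ dist c a = dist z x := by
  rcases (dist_nonneg (x := x) (y := y)).eq_or_lt' with h0 | h0
  · obtain rfl := dist_eq_zero.1 h0
    refine ⟨!₂[0, 0], !₂[0, 0], !₂[dist x z, 0], ?_, ?_, ?_⟩
    · simp
    · simp [EuclideanSpace.dist_eq, Real.dist_eq]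
    · simp [EuclideanSpace.dist_eq, Real.dist_eq, dist_comm]
  · set p := dist x y
    set q := dist y z with hq
    set r := dist z x with hr
    have hq0 : 0 ≤ q := dist_nonneg
    have hr0 : 0 ≤ r := dist_nonneg
    have t1 : q ≤ p + r := by
      have := dist_triangle y x z
      rw [dist_comm y x, dist_comm x z] at this; exact this
    have t2 : r ≤ q + p := by
      have := dist_triangle z y x
      rw [dist_comm y x, dist_comm z y] at this; exact this
    have t3 : p ≤ r + q := by
      have := dist_triangle x z y
      rw [dist_comm x z, dist_comm z y] at this; exact this
    obtain ⟨w, hw⟩ : ∃ w, w = (r ^ 2 + p ^ 2 - q ^ 2) / (2 * p) := ⟨_, rfl⟩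
    have hw' : 2 * p * w = r ^ 2 + p ^ 2 - q ^ 2 := by rw [hw]; field_simp
    have hwr : 0 ≤ r ^ 2 - w ^ 2 := by
      have k1 : w ≤ r := by
        by_contra! h
        nlinarith
      have k2 : -r ≤ w := by
        by_contra! h
        nlinarith
      nlinarith
    refine ⟨!₂[0, 0], !₂[p, 0], !₂[w, √(r ^ 2 - w ^ 2)], ?_, ?_, ?_⟩
    · simp [EuclideanSpace.dist_eq, Real.dist_eq, Real.sqrt_sq_eq_abs, abs_of_pos h0]
    · simp only [EuclideanSpace.dist_eq, Real.dist_eq, Fin.sum_univ_two, sq_abs]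
      simp only [Matrix.cons_val_zero, Matrix.cons_val_one, zero_sub, neg_sq, Real.sq_sqrt hwr]
      rw [← Real.sqrt_sq hq0]
      congr 1
      linarith
    · simp only [EuclideanSpace.dist_eq, Real.dist_eq, Fin.sum_univ_two, sq_abs]
      simp only [Matrix.cons_val_zero, Matrix.cons_val_one, sub_zero, Real.sq_sqrt hwr]
      conv_rhs => rw [← Real.sqrt_sq hr0]
      congr 1
      linarith

theorem IsCATZero.satisfiesBruhatTits (hX : IsCATZero X) : SatisfiesBruhatTits X := by
  intro x y t ht0 ht1
  obtain ⟨γ, hγ⟩ := hX.geodesic x y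
  refine ⟨γ ⟨t, ht0, ht1⟩, fun z => ?_⟩
  obtain ⟨γ₁, h₁⟩ := hX.geodesic y z
  obtain ⟨γ₂, h₂⟩ := hX.geodesic z x
  obtain ⟨a, b, c, hab, hbc, hca⟩ := exists_comparison x y z
  have htri : IsGeodesicTriangle ![x, y, z] ![γ, γ₁, γ₂] := by
    refine ⟨fun i => ?_⟩
    fin_cases i
    · exact hγ
    · exact h₁
    · exact h₂
  have hcomp : IsComparisonTriangle ![x, y, z] ![a, b, c] := by
    intro i j
    fin_cases i <;> fin_cases j <;> simp [hab, hbc, hca]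
    · rw [dist_comm, hca, dist_comm]
    · rw [dist_comm, hab, dist_comm]
    · rw [dist_comm, hbc, dist_comm]
  have key := hX.thin _ _ htri _ hcomp 2 0 0 ⟨t, ht0, ht1⟩
  have e : γ₂ 0 = z := h₂.map_zero
  simp [e] at key
  calc dist z (γ ⟨t, ht0, ht1⟩) ^ 2 ≤ dist c (AffineMap.lineMap a b t) ^ 2 := by gcongr
    _ = _ := by rw [dist_lineMap_sq, hca, dist_comm c b, hbc, hab, dist_comm y z]

/-- With `p`, `q`, `m` the distances of a point to `x`, `y` and to a division point of `[x, y]`: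
the inequality of Bruhat and Tits makes the distance to the point a convex function. -/
theorem le_of_sq_le_bruhatTits {p q D t m : ℝ} (hp : 0 ≤ p) (hq : 0 ≤ q) (ht0 : 0 ≤ t) (ht1 : t ≤ 1)
    (hpq : |p - q| ≤ D) (hm : m ^ 2 ≤ (1 - t) * p ^ 2 + t * q ^ 2 - t * (1 - t) * D ^ 2) :
    m ≤ (1 - t) * p + t * q := by
  have h1 : (p - q) ^ 2 ≤ D ^ 2 := sq_le_sq' (by linarith [neg_abs_le (p - q)])
    ((le_abs_self _).trans hpq)
  have h2 : 0 ≤ 1 - t := by linarith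
  refine le_of_sq_le_sq ?_ (by positivity)
  nlinarith [mul_nonneg ht0 h2, mul_le_mul_of_nonneg_left h1 (mul_nonneg ht0 h2)]

/-- The inequality of Bruhat and Tits holds along every geodesic. Applying the inequality for the
given point `m` to `z = γ t` shows that `γ t = m`. -/
theorem SatisfiesBruhatTits.dist_geodesic_sq_le (hX : SatisfiesBruhatTits X) {x y : X}
    {γ : unitInterval → X} (hγ : IsGeodesicFromTo γ x y) (t : unitInterval) (z : X) :
    dist z (γ t) ^ 2 ≤
      (1 - t) * dist z x ^ 2 + t * dist z y ^ 2 - t * (1 - t) * dist x y ^ 2 := by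
  obtain ⟨m, hm⟩ := hX x y t t.2.1 t.2.2
  have h0 : dist (γ t) x = t * dist x y := by
    have := hγ.dist_map t 0
    rw [hγ.map_zero] at this
    rw [this]; simp [abs_of_nonneg t.2.1]
  have h1 : dist (γ t) y = (1 - t) * dist x y := by
    have := hγ.dist_map t 1
    rw [hγ.map_one] at this
    rw [this, abs_sub_comm]; simp [abs_of_nonneg (sub_nonneg.2 t.2.2)]
  have h2 := hm (γ t)
  rw [h0, h1] at h2
  have h3 : dist (γ t) m ^ 2 ≤ 0 := h2.trans_eq (by ring)
  have h4 : dist (γ t) m = 0 := by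
    have := sq_nonneg (dist (γ t) m)
    exact pow_eq_zero_iff two_ne_zero |>.1 (le_antisymm h3 this)
  rw [dist_eq_zero.1 h4]
  exact hm z

theorem SatisfiesBruhatTits.isGeodesicMetricSpace (hX : SatisfiesBruhatTits X) :
    IsGeodesicMetricSpace X := by
  intro x y
  choose γ hγ using fun t : unitInterval => hX x y t t.2.1 t.2.2
  have hx : ∀ t : unitInterval, dist x (γ t) ≤ t * dist x y := fun t => by
    have h := hγ t x
    rw [dist_self] at h
    exact le_of_sq_le_sq (h.trans_eq (by ring)) (mul_nonneg t.2.1 dist_nonneg)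
  have hy : ∀ t : unitInterval, dist y (γ t) ≤ (1 - t) * dist x y := fun t => by
    have h := hγ t y
    rw [dist_self, dist_comm y x] at h
    exact le_of_sq_le_sq (h.trans_eq (by ring)) (mul_nonneg (sub_nonneg.2 t.2.2) dist_nonneg)
  have hst : ∀ s t : unitInterval, dist (γ s) (γ t) ≤ |(s : ℝ) - t| * dist x y := fun s t => by
    have h := hγ t (γ s)
    have h1 : dist (γ s) x ^ 2 ≤ (s * dist x y) ^ 2 := by
      rw [dist_comm]; exact pow_le_pow_left₀ dist_nonneg (hx s) 2
    have h2 : dist (γ s) y ^ 2 ≤ ((1 - s) * dist x y) ^ 2 := by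
      rw [dist_comm]; exact pow_le_pow_left₀ dist_nonneg (hy s) 2
    refine le_of_sq_le_sq ?_ (by positivity)
    rw [mul_pow, sq_abs]
    nlinarith [mul_le_mul_of_nonneg_left h1 (sub_nonneg.2 t.2.2),
      mul_le_mul_of_nonneg_left h2 t.2.1]
  -- The reverse inequality holds since `x`, `γ s`, `γ t`, `y` is a path of length at most
  -- `dist x y`.
  have key : ∀ s t : unitInterval, s ≤ t → dist (γ s) (γ t) = |(s : ℝ) - t| * dist x y := by
    intro s t h
    refine le_antisymm (hst s t) ?_
    have h' : (s : ℝ) ≤ t := h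
    rw [abs_sub_comm, abs_of_nonneg (sub_nonneg.2 h')]
    have h1 := dist_triangle4 x (γ s) (γ t) y
    have h2 := hy t
    rw [dist_comm] at h2
    linarith [hx s]
  refine ⟨γ, ?_, ?_, fun s t => ?_⟩
  · have h := hx 0
    rw [Set.Icc.coe_zero, zero_mul] at h
    exact (dist_le_zero.1 h).symm
  · have h := hy 1
    rw [Set.Icc.coe_one, sub_self, zero_mul] at h
    exact (dist_le_zero.1 h).symm
  · rcases le_total s t with h | h
    · exact key s t h
    · rw [dist_comm, abs_sub_comm]; exact key t s h

/-- The comparison of two points on two sides with a common vertex `y`, by applying the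
inequality of Bruhat and Tits once to each of the two sides. -/
theorem SatisfiesBruhatTits.dist_adjacent_le (hX : SatisfiesBruhatTits X) {x y z : X}
    {γ η : unitInterval → X} (hγ : IsGeodesicFromTo γ x y) (hη : IsGeodesicFromTo η y z)
    {E : Type*} [NormedAddCommGroup E] [InnerProductSpace ℝ E] {a b c : E}
    (hab : dist a b = dist x y) (hbc : dist b c = dist y z) (hca : dist c a = dist z x)
    (s t : unitInterval) :
    dist (γ s) (η t) ≤
      dist (AffineMap.lineMap a b (s : ℝ)) (AffineMap.lineMap b c (t : ℝ)) := by
  refine le_of_sq_le_sq ?_ dist_nonneg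
  have h0 := hX.dist_geodesic_sq_le hη t (γ s)
  have h1 := hX.dist_geodesic_sq_le hγ s z
  have h2 := hX.dist_geodesic_sq_le hγ s y
  rw [dist_comm (γ s) y, dist_comm (γ s) z] at h0
  rw [dist_comm z y] at h1
  rw [dist_comm y x, dist_self] at h2
  have e1 := dist_lineMap_sq a b c s
  have e2 := dist_lineMap_sq a b b s
  rw [dist_lineMap_sq, dist_comm _ b, dist_comm _ c, e1, e2, dist_self, dist_comm b a,
    dist_comm c b, hab, hbc, hca]
  have ht := t.2.1
  have ht' := sub_nonneg.2 t.2.2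
  nlinarith [mul_le_mul_of_nonneg_left h1 ht, mul_le_mul_of_nonneg_left h2 ht']

theorem SatisfiesBruhatTits.isCATZero (hX : SatisfiesBruhatTits X) : IsCATZero X := by
  refine ⟨hX.isGeodesicMetricSpace, fun p side hp q hq i j s t => ?_⟩
  have same : ∀ (i : Fin 3) (s t : unitInterval), dist (side i s) (side i t) ≤
      dist (AffineMap.lineMap (q i) (q (i + 1)) (s : ℝ))
        (AffineMap.lineMap (q i) (q (i + 1)) (t : ℝ)) := fun i s t => by
    rw [(hp.geodesic i).dist_map, dist_lineMap_lineMap, hq, Real.dist_eq]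
  have next : ∀ (i : Fin 3) (s t : unitInterval), dist (side i s) (side (i + 1) t) ≤
      dist (AffineMap.lineMap (q i) (q (i + 1)) (s : ℝ))
        (AffineMap.lineMap (q (i + 1)) (q (i + 1 + 1)) (t : ℝ)) := fun i s t =>
    hX.dist_adjacent_le (hp.geodesic i) (hp.geodesic (i + 1)) (hq _ _) (hq _ _) (hq _ _) s t
  have hij : j = i ∨ j = i + 1 ∨ i = j + 1 := by revert i j; decide
  rcases hij with rfl | rfl | rfl
  · exact same _ s t
  · exact next _ s t
  · rw [dist_comm, dist_comm (AffineMap.lineMap _ _ _)]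
    exact next _ t s

end BruhatTits

/-! ### Bouquets of pointed spaces -/

/-- A point of one of the spaces `G i`, which are going to be glued together at their base
points. -/
structure Spoke {I : Type} (G : I → PointedProperSpace.{u}) where
  idx : I
  pt : (G idx).carrier

namespace Spoke

variable {I : Type} {G : I → PointedProperSpace.{u}}

/-- The distance from the base point. -/
noncomputable def radius (x : Spoke G) : ℝ := dist x.pt (G x.idx).base

theorem radius_nonneg (x : Spoke G) : 0 ≤ x.radius := dist_nonneg

open Classical in
/-- Two points on different spokes are joined through the common base point. All the base points
are at distance `0` of each other. -/
noncomputable instance : PseudoMetricSpace (Spoke G) where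
  dist x y := if h : x.idx = y.idx then dist (h ▸ x.pt) y.pt else x.radius + y.radius
  dist_self x := by simp
  dist_comm x y := by
    obtain ⟨i, x⟩ := x
    obtain ⟨j, y⟩ := y
    by_cases h : i = j
    · subst h; simp [dist_comm]
    · simp [h, Ne.symm h, add_comm]
  dist_triangle x y z := by
    obtain ⟨i, x⟩ := x
    obtain ⟨j, y⟩ := y
    obtain ⟨k, z⟩ := z
    have hx := radius_nonneg (⟨i, x⟩ : Spoke G)
    have hy := radius_nonneg (⟨j, y⟩ : Spoke G)
    have hz := radius_nonneg (⟨k, z⟩ : Spoke G)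
    by_cases hij : i = j <;> by_cases hjk : j = k
    · subst hij hjk; simpa using dist_triangle _ _ _
    · subst hij
      simp only [hjk, dite_true, dite_false, radius]
      linarith [dist_triangle x y (G i).base]
    · subst hjk
      simp only [hij, dite_true, dite_false, radius]
      linarith [dist_triangle_left z (G j).base y]
    · by_cases hik : i = k
      · subst hik
        simp only [hij, hjk, dite_true, dite_false]
        have := dist_triangle_right x z (G i).base
        simp only [radius] at hx hy hz ⊢
        linarith
      · simp only [hij, hjk, hik, dite_false]
        linarith

theorem dist_mk_mk (i : I) (x y : (G i).carrier) :
    dist (⟨i, x⟩ : Spoke G) ⟨i, y⟩ = dist x y := by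
  classical
  change dite _ _ _ = _
  simp

theorem dist_of_ne {x y : Spoke G} (h : x.idx ≠ y.idx) : dist x y = x.radius + y.radius := by
  classical
  change dite _ _ _ = _
  simp [h]

theorem radius_mk (i : I) (x : (G i).carrier) :
    radius (⟨i, x⟩ : Spoke G) = dist x (G i).base := rfl

theorem dist_le_add (x y : Spoke G) : dist x y ≤ x.radius + y.radius := by
  by_cases h : x.idx = y.idx
  · obtain ⟨i, x⟩ := x
    obtain ⟨j, y⟩ := y
    obtain rfl : i = j := h
    rw [dist_mk_mk, radius_mk, radius_mk]
    exact dist_triangle_right _ _ _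
  · exact (dist_of_ne h).le

theorem abs_radius_sub_le (x y : Spoke G) : |x.radius - y.radius| ≤ dist x y := by
  by_cases h : x.idx = y.idx
  · obtain ⟨i, x⟩ := x
    obtain ⟨j, y⟩ := y
    obtain rfl : i = j := h
    rw [dist_mk_mk, radius_mk, radius_mk]
    exact abs_dist_sub_le _ _ _
  · rw [dist_of_ne h, abs_le]
    constructor <;> linarith [x.radius_nonneg, y.radius_nonneg]

/-- The base point of the `i`-th spoke. -/
def center (G : I → PointedProperSpace.{u}) (i : I) : Spoke G := ⟨i, (G i).base⟩

theorem radius_center (i : I) : (center G i).radius = 0 := dist_self _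

theorem dist_center (x : Spoke G) (i : I) : dist x (center G i) = x.radius := by
  refine le_antisymm ?_ ?_
  · simpa [radius_center] using dist_le_add x (center G i)
  · simpa [radius_center, abs_of_nonneg x.radius_nonneg] using abs_radius_sub_le x (center G i)

/-! ### The inequality of Bruhat and Tits in bouquets -/

/-- The inequality of Bruhat and Tits for a division point `m` of `[x, y]` on the spoke of `x`,
where `x` and `y` lie on different spokes. The auxiliary `s` is the ratio in which `m` divides the
segment from `x` to the base point. In each case equality holds on the real line. -/
theorem exists_division_point_of_ne (hG : ∀ i, SatisfiesBruhatTits (G i).carrier) {x y : Spoke G}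
    (hxy : x.idx ≠ y.idx) {t : ℝ} (ht0 : 0 ≤ t)
    (ht : t * (x.radius + y.radius) ≤ x.radius) :
    ∃ m : Spoke G, (m.idx = x.idx ∧ m.radius ≤ x.radius) ∧ ∀ z, dist z m ^ 2 ≤
      (1 - t) * dist z x ^ 2 + t * dist z y ^ 2 - t * (1 - t) * dist x y ^ 2 := by
  set p := x.radius with hp
  set q := y.radius
  have hp0 : 0 ≤ p := x.radius_nonneg
  have hq0 : 0 ≤ q := y.radius_nonneg
  obtain ⟨s, hs0, hs1, hs, hst⟩ : ∃ s : ℝ, 0 ≤ s ∧ s ≤ 1 ∧ s * p = t * (p + q) ∧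
      (0 < p → t ≤ s) := by
    rcases hp0.eq_or_lt' with h | h
    · refine ⟨0, le_rfl, zero_le_one, ?_, fun h' => absurd h h'.ne'⟩
      have := mul_nonneg ht0 (add_nonneg hp0 hq0)
      linarith
    · refine ⟨t * (p + q) / p, by positivity, (div_le_one h).2 ht, by field_simp, fun _ => ?_⟩
      rw [le_div_iff₀ h]
      nlinarith
  obtain ⟨i, x⟩ := x
  obtain ⟨m, hm⟩ := hG i x (G i).base s hs0 hs1
  have hmp : dist m (G i).base ≤ (1 - s) * p := by
    have := hm (G i).base
    rw [dist_self, dist_comm _ x, ← radius_mk, ← hp, dist_comm] at this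
    exact le_of_sq_le_sq (this.trans_eq (by ring)) (mul_nonneg (by linarith) hp0)
  refine ⟨⟨i, m⟩, ⟨rfl, hmp.trans (by nlinarith)⟩, fun z => ?_⟩
  rw [dist_of_ne hxy, ← hp]
  by_cases hz : z.idx = i
  · obtain ⟨j, z⟩ := z
    obtain rfl : j = i := hz
    have e1 := dist_of_ne (x := ⟨j, z⟩) hxy
    rw [e1, dist_mk_mk, dist_mk_mk]
    change _ ≤ (1 - t) * dist z x ^ 2 + t * (dist z (G j).base + q) ^ 2 - _
    have h1 := hm z
    have hp' : p = dist x (G j).base := hp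
    rw [← hp'] at h1
    set e := dist z (G j).base with he
    set f := dist z x
    have hf0 : 0 ≤ f := dist_nonneg
    have hf1 : (p - e) ^ 2 ≤ f ^ 2 := by
      have := abs_dist_sub_le x z (G j).base
      rw [← hp', ← he, dist_comm x z] at this
      rw [← sq_abs (p - e)]
      exact pow_le_pow_left₀ (abs_nonneg _) this 2
    have hf2 : 0 ≤ (s - t) * (f ^ 2 - (p - e) ^ 2) := by
      rcases hp0.eq_or_lt' with h | h
      · have h2 : f ≤ e := by
          have := dist_triangle_right z x (G j).base
          rw [← hp', h] at this; linarith
        have h3 : f ^ 2 = (p - e) ^ 2 := by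
          refine le_antisymm ?_ hf1
          rw [h, zero_sub, neg_sq]
          exact pow_le_pow_left₀ hf0 h2 2
        rw [h3, sub_self, mul_zero]
      · exact mul_nonneg (sub_nonneg.2 (hst h)) (sub_nonneg.2 hf1)
    have h4 : (1 - t) * f ^ 2 + t * (e + q) ^ 2 - t * (1 - t) * (p + q) ^ 2 =
        (1 - s) * f ^ 2 + s * e ^ 2 - s * (1 - s) * p ^ 2 +
          (s - t) * (f ^ 2 - (p - e) ^ 2) := by
      linear_combination (2 * p - 2 * e - s * p - t * (p + q)) * hs
    linarith
  · rw [dist_of_ne (x := z) hz, dist_of_ne (x := z) hz, radius_mk i m, ← hp]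
    have hg : (z.radius - q) ^ 2 ≤ dist z y ^ 2 := by
      rw [← sq_abs (z.radius - q)]
      exact pow_le_pow_left₀ (abs_nonneg _) (abs_radius_sub_le _ _) 2
    have hz0 := z.radius_nonneg
    set e := z.radius
    have h1 : (e + dist m (G i).base) ^ 2 ≤ (e + (1 - s) * p) ^ 2 := by gcongr
    have h2 : (e + (1 - s) * p) ^ 2 =
        (1 - t) * (e + p) ^ 2 + t * (e - q) ^ 2 - t * (1 - t) * (p + q) ^ 2 := by
      linear_combination (- 2 * e - 2 * p + s * p + t * (p + q)) * hs
    linarith [mul_le_mul_of_nonneg_left hg ht0]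

theorem exists_division_point (hG : ∀ i, SatisfiesBruhatTits (G i).carrier) (x y : Spoke G)
    {t : ℝ} (ht0 : 0 ≤ t) (ht1 : t ≤ 1) :
    ∃ m : Spoke G, ((m.idx = x.idx ∧ m.radius ≤ x.radius) ∨
      (m.idx = y.idx ∧ m.radius ≤ y.radius)) ∧ ∀ z, dist z m ^ 2 ≤
        (1 - t) * dist z x ^ 2 + t * dist z y ^ 2 - t * (1 - t) * dist x y ^ 2 := by
  have ht1' : 0 ≤ 1 - t := sub_nonneg.2 ht1
  by_cases hxy : x.idx = y.idx
  · obtain ⟨i, x⟩ := x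
    obtain ⟨j, y⟩ := y
    obtain rfl : i = j := hxy
    obtain ⟨m, hm⟩ := hG i x y t ht0 ht1
    have hmr : dist m (G i).base ≤ (1 - t) * dist x (G i).base + t * dist y (G i).base := by
      have := hm (G i).base
      rw [dist_comm _ x, dist_comm _ y, dist_comm] at this
      exact le_of_sq_le_bruhatTits dist_nonneg dist_nonneg ht0 ht1 (abs_dist_sub_le _ _ _) this
    refine ⟨⟨i, m⟩, ?_, fun z => ?_⟩
    · simp only [radius_mk, true_and]
      by_contra! h
      obtain ⟨h1, h2⟩ := h
      rcases ht0.eq_or_lt with rfl | ht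
      · linarith
      · nlinarith [mul_lt_mul_of_pos_left h2 ht, mul_le_mul_of_nonneg_left h1.le ht1']
    · by_cases hz : z.idx = i
      · obtain ⟨k, z⟩ := z
        obtain rfl : k = i := hz
        simpa only [dist_mk_mk] using hm z
      · rw [dist_of_ne (x := z) hz, dist_of_ne (x := z) hz, dist_of_ne (x := z) hz, dist_mk_mk]
        simp only [radius_mk i]
        have h0 := hm (G i).base
        rw [dist_comm _ x, dist_comm _ y, dist_comm _ m] at h0
        nlinarith [mul_le_mul_of_nonneg_left hmr z.radius_nonneg]
  · rcases le_total (t * (x.radius + y.radius)) x.radius with h | h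
    · obtain ⟨m, hm, hm'⟩ := exists_division_point_of_ne hG hxy ht0 h
      exact ⟨m, Or.inl hm, hm'⟩
    · obtain ⟨m, hm, hm'⟩ := exists_division_point_of_ne hG (Ne.symm hxy) ht1'
        (by linarith)
      refine ⟨m, Or.inr hm, fun z => (hm' z).trans_eq ?_⟩
      rw [dist_comm y x]; ring

end Spoke

/-! ### Truncated bouquets as pointed proper metric spaces -/

section Bouquet

open scoped ENNReal

variable {I : Type}

/-- The bouquet of the pointed spaces `G i`: their disjoint union, with all the base points
identified. -/
abbrev Bouquet (G : I → PointedProperSpace.{u}) := SeparationQuotient (Spoke G)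

namespace Bouquet

variable {G : I → PointedProperSpace.{u}}

/-- The part of the bouquet in which the space `G i` is replaced by its closed ball of radius
`R i` about the base point; `R i = ∞` keeps the whole of `G i`. -/
def trunc (G : I → PointedProperSpace.{u}) (R : I → ℝ≥0∞) : Set (Bouquet G) :=
  SeparationQuotient.mk '' {x | ENNReal.ofReal x.radius ≤ R x.idx}

theorem mk_mem_trunc {R : I → ℝ≥0∞} {x : Spoke G} (hx : ENNReal.ofReal x.radius ≤ R x.idx) :
    SeparationQuotient.mk x ∈ trunc G R :=
  ⟨x, hx, rfl⟩

/-- The base point of a truncated bouquet. It does not depend on `i`. -/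
noncomputable def truncBase (G : I → PointedProperSpace.{u}) (R : I → ℝ≥0∞) (i : I) : trunc G R :=
  ⟨SeparationQuotient.mk (Spoke.center G i), mk_mem_trunc (by simp [Spoke.radius_center])⟩

theorem satisfiesBruhatTits_trunc (hG : ∀ i, SatisfiesBruhatTits (G i).carrier)
    (R : I → ℝ≥0∞) : SatisfiesBruhatTits (trunc G R) := by
  rintro ⟨_, x, hx, rfl⟩ ⟨_, y, hy, rfl⟩ t ht0 ht1
  obtain ⟨m, hm, hm'⟩ := Spoke.exists_division_point hG x y ht0 ht1
  refine ⟨⟨_, mk_mem_trunc (x := m) ?_⟩, ?_⟩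
  · rcases hm with ⟨h1, h2⟩ | ⟨h1, h2⟩
    · rw [h1]; exact (ENNReal.ofReal_le_ofReal h2).trans hx
    · rw [h1]; exact (ENNReal.ofReal_le_ofReal h2).trans hy
  · rintro ⟨_, z, hz, rfl⟩
    exact hm' z

/-- If only finitely many spokes have large radius, then the spokes accumulate only at the base
point, so that truncated bouquets of proper spaces have compact balls. -/
theorem isCompact_spokes {R : I → ℝ≥0∞} (hR : ∀ ε, 0 < ε → {i | ε < R i}.Finite) (r : ℝ) :
    IsCompact {x : Spoke G | ENNReal.ofReal x.radius ≤ R x.idx ∧ x.radius ≤ r} := by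
  set K := {x : Spoke G | ENNReal.ofReal x.radius ≤ R x.idx ∧ x.radius ≤ r}
  rw [isCompact_iff_ultrafilter_le_nhds]
  intro F hF
  rw [le_principal_iff] at hF
  by_cases h : ∃ i, ∀ᶠ x in (F : Filter (Spoke G)), x.idx = i
  · obtain ⟨i, hi⟩ := h
    have hiso : Isometry (Spoke.mk (G := G) i) := Isometry.of_dist_eq (Spoke.dist_mk_mk i)
    have hc : IsCompact (Metric.closedBall (G i).base r ∩
        {y | ENNReal.ofReal (dist y (G i).base) ≤ R i}) :=
      (isCompact_closedBall _ _).inter_right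
        (isClosed_le (ENNReal.continuous_ofReal.comp (continuous_id.dist continuous_const))
          continuous_const)
    obtain ⟨z, hz, hz'⟩ := (hc.image hiso.continuous).ultrafilter_le_nhds F (by
      rw [le_principal_iff]
      filter_upwards [hF, hi]
      rintro ⟨j, y⟩ hy rfl
      exact ⟨y, ⟨hy.2, hy.1⟩, rfl⟩)
    refine ⟨z, ?_, hz'⟩
    obtain ⟨y, hy, rfl⟩ := hz
    exact ⟨hy.2, hy.1⟩
  · obtain ⟨x₀, hx₀⟩ := F.nonempty_of_mem hF
    refine ⟨Spoke.center G x₀.idx, ⟨by simp [Spoke.radius_center], ?_⟩, ?_⟩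
    · rw [Spoke.radius_center]; exact x₀.radius_nonneg.trans hx₀.2
    · rw [Metric.nhds_basis_ball.ge_iff]
      intro ε hε
      have hfin : ∀ᶠ x in (F : Filter (Spoke G)),
          ∀ i ∈ {i | ENNReal.ofReal (ε / 2) < R i}, x.idx ≠ i :=
        (eventually_all_finite (hR _ (ENNReal.ofReal_pos.2 (half_pos hε)))).2 fun i _ =>
          Ultrafilter.eventually_not.2 fun hi => h ⟨i, hi⟩
      filter_upwards [hF, hfin] with x hx hx'
      have h1 : R x.idx ≤ ENNReal.ofReal (ε / 2) := by
        by_contra! h2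
        exact hx' _ h2 rfl
      rw [Metric.mem_ball, Spoke.dist_center]
      have h2 := (ENNReal.ofReal_le_ofReal_iff (half_pos hε).le).1 (hx.1.trans h1)
      linarith

theorem properSpace_trunc {R : I → ℝ≥0∞} (hR : ∀ ε, 0 < ε → {i | ε < R i}.Finite) (i : I) :
    ProperSpace (trunc G R) := by
  refine ProperSpace.of_seq_closedBall (x := truncBase G R i) (r := id) (l := atTop) tendsto_id
    (Eventually.of_forall fun r => ?_)
  rw [Subtype.isCompact_iff]
  have himage : Subtype.val '' Metric.closedBall (truncBase G R i) r =
      SeparationQuotient.mk ''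
        {x : Spoke G | ENNReal.ofReal x.radius ≤ R x.idx ∧ x.radius ≤ r} := by
    refine Set.ext fun w => ⟨?_, ?_⟩
    · rintro ⟨⟨_, x, hx, rfl⟩, h, rfl⟩
      refine ⟨x, ⟨hx, ?_⟩, rfl⟩
      rw [← Spoke.dist_center x i]
      exact h
    · rintro ⟨x, ⟨hx, hr⟩, rfl⟩
      refine ⟨⟨_, mk_mem_trunc hx⟩, ?_, rfl⟩
      rw [← Spoke.dist_center x i] at hr
      exact hr
  rw [id, himage]
  exact (isCompact_spokes (G := G) hR r).image SeparationQuotient.continuous_mk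

end Bouquet

open Bouquet

/-- A truncated bouquet as a pointed proper metric space. -/
noncomputable def PointedProperSpace.bouquet (G : I → PointedProperSpace.{u}) (i : I)
    (R : I → ℝ≥0∞) (hR : ∀ ε, 0 < ε → {i | ε < R i}.Finite) : PointedProperSpace.{u} where
  carrier := trunc G R
  properSpace := properSpace_trunc hR i
  base := truncBase G R i

variable {G : I → PointedProperSpace.{u}}

/-- Move a point of a spoke towards the base point until it lies in a truncation. -/
theorem Spoke.exists_dist_le_of_radius_le (hG : ∀ i, IsGeodesicMetricSpace (G i).carrier)
    (x : Spoke G) {r : ℝ≥0∞} {δ : ℝ} (hδ : 0 ≤ δ)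
    (h : ENNReal.ofReal x.radius ≤ r + ENNReal.ofReal δ) :
    ∃ y : Spoke G, y.idx = x.idx ∧ ENNReal.ofReal y.radius ≤ r ∧ dist x y ≤ δ := by
  by_cases hr : ENNReal.ofReal x.radius ≤ r
  · exact ⟨x, rfl, hr, by rwa [dist_self]⟩
  · rw [not_le] at hr
    lift r to NNReal using (hr.trans ENNReal.ofReal_lt_top).ne
    rw [ENNReal.coe_nnreal_eq, ENNReal.ofReal_lt_ofReal_iff'] at hr
    rw [ENNReal.coe_nnreal_eq, ← ENNReal.ofReal_add r.coe_nonneg hδ,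
      ENNReal.ofReal_le_ofReal_iff (add_nonneg r.coe_nonneg hδ)] at h
    obtain ⟨i, x⟩ := x
    obtain ⟨hr, hx⟩ := hr
    obtain ⟨γ, hγ⟩ := hG i (G i).base x
    simp only [radius_mk] at h hr hx
    rw [dist_comm] at hr h hx
    have hs1 : r / dist (G i).base x ≤ 1 := (div_le_one hx).2 hr.le
    let s : unitInterval := ⟨r / dist (G i).base x, by positivity, hs1⟩
    refine ⟨⟨i, γ s⟩, rfl, ?_, ?_⟩
    · have h0 := hγ.dist_map s 0
      rw [hγ.map_zero] at h0
      rw [radius_mk, h0, ENNReal.coe_nnreal_eq]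
      refine ENNReal.ofReal_le_ofReal (le_of_eq ?_)
      have : 0 ≤ (r : ℝ) / dist (G i).base x := by positivity
      simp only [s, Set.Icc.coe_zero, sub_zero, abs_of_nonneg this]
      field_simp
    · have h0 := hγ.dist_map 1 s
      rw [hγ.map_one] at h0
      rw [dist_mk_mk, h0, Set.Icc.coe_one, abs_of_nonneg (sub_nonneg.2 hs1), sub_mul, one_mul]
      change dist (G i).base x - r / dist (G i).base x * dist (G i).base x ≤ δ
      rw [div_mul_cancel₀ _ hx.ne']
      linarith

theorem pghDist_bouquet_le (hG : ∀ i, IsGeodesicMetricSpace (G i).carrier) (i : I)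
    {R R' : I → ℝ≥0∞} (hR : ∀ ε, 0 < ε → {i | ε < R i}.Finite)
    (hR' : ∀ ε, 0 < ε → {i | ε < R' i}.Finite) {t : ℝ} (ht : 0 < t)
    (h : ∀ i, min (R i) (ENNReal.ofReal t⁻¹) ≤ R' i + ENNReal.ofReal (t / 4))
    (h' : ∀ i, min (R' i) (ENNReal.ofReal t⁻¹) ≤ R i + ENNReal.ofReal (t / 4)) :
    PointedProperSpace.pghDist (.bouquet G i R hR) (.bouquet G i R' hR') ≤ t := by
  have key : ∀ {R R' : I → ℝ≥0∞},
      (∀ i, min (R i) (ENNReal.ofReal t⁻¹) ≤ R' i + ENNReal.ofReal (t / 4)) →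
      ∀ x : trunc G R, dist x (truncBase G R i) ≤ t⁻¹ →
        ∃ y : trunc G R', dist (x : Bouquet G) y ≤ t / 4 := by
    intro R R' h
    rintro ⟨_, x, hx, rfl⟩ hxt
    have hxt' : x.radius ≤ t⁻¹ := by
      rw [← Spoke.dist_center x i]; exact hxt
    obtain ⟨y, hyi, hy, hxy⟩ := x.exists_dist_le_of_radius_le hG (by positivity : 0 ≤ t / 4)
      ((le_min hx (ENNReal.ofReal_le_ofReal hxt')).trans (h x.idx))
    exact ⟨⟨_, mk_mem_trunc (x := y) (by rwa [hyi])⟩, hxy⟩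
  have hcross : IsCross t (truncBase G R i) (truncBase G R' i)
      (fun x y => dist (x : Bouquet G) y + t / 2) := by
    refine ⟨?_, ?_, ?_, ?_, ?_, ?_, ?_, ?_⟩
    · intro x y; positivity
    · intro x x' y
      linarith [dist_triangle x.1 x'.1 y.1, Subtype.dist_eq x x']
    · intro x y y'
      linarith [dist_triangle x.1 y'.1 y.1, Subtype.dist_eq y' y]
    · intro x x' y
      linarith [dist_triangle_right x.1 x'.1 y.1, Subtype.dist_eq x x']
    · intro x y y'
      linarith [dist_triangle_left y.1 y'.1 x.1, Subtype.dist_eq y y']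
    · change dist (SeparationQuotient.mk (Spoke.center G i)) (SeparationQuotient.mk _) + t / 2 < t
      rw [dist_self]; linarith
    · intro x hx
      obtain ⟨y, hy⟩ := key h x hx
      exact ⟨y, by linarith⟩
    · intro y hy
      obtain ⟨x, hx⟩ := key h' y hy
      exact ⟨x, by rw [dist_comm]; linarith⟩
  exact (min_le_left _ _).trans (PointedProperSpace.preDist_le hcross)

/-- The radii of the spokes may vary continuously in `[0, ∞]`, as long as all but finitely many
of them stay below every given bound. -/
theorem continuous_mk_bouquet (hG : ∀ i, IsGeodesicMetricSpace (G i).carrier) (i : I)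
    {H : Type v} [TopologicalSpace H] {R : H → I → ℝ≥0∞} {B : I → ℝ≥0∞}
    (hB : ∀ ε, 0 < ε → {i | ε < B i}.Finite) (hRB : ∀ x i, R x i ≤ B i)
    (hR : ∀ x ε, 0 < ε → {i | ε < R x i}.Finite) (hc : ∀ i, Continuous fun x => R x i) :
    Continuous fun x => PointedGHSpace.mk (.bouquet G i (R x) (hR x)) := by
  rw [continuous_iff_continuousAt]
  intro x₀
  refine Metric.tendsto_nhds.2 fun ε hε => ?_
  have ht : 0 < ε / 2 := half_pos hε
  set C := ENNReal.ofReal (ε / 2)⁻¹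
  set δ := ENNReal.ofReal (ε / 2 / 4)
  have hδ : 0 < δ := ENNReal.ofReal_pos.2 (by positivity)
  have hev : ∀ᶠ x in 𝓝 x₀, ∀ i ∈ {i | δ < B i},
      min (R x i) C ≤ R x₀ i + δ ∧ min (R x₀ i) C ≤ R x i + δ := by
    refine (eventually_all_finite (hB δ hδ)).2 fun i _ => ?_
    have hci := (hc i).tendsto x₀
    refine .and ?_ ?_
    · by_cases h : R x₀ i = ∞
      · simp [h]
      · filter_upwards [hci.eventually_lt_const (ENNReal.lt_add_right h hδ.ne')] with x hx
        exact (min_le_left _ _).trans hx.le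
    · by_cases h : min (R x₀ i) C = 0
      · simp [h]
      · have h1 : min (R x₀ i) C - δ < R x₀ i :=
          (ENNReal.sub_lt_self ((min_le_right _ _).trans_lt ENNReal.ofReal_lt_top).ne h
            hδ.ne').trans_le (min_le_left _ _)
        filter_upwards [hci.eventually_const_lt h1] with x hx
        exact tsub_le_iff_right.1 hx.le
  filter_upwards [hev] with x hx
  have hx' : ∀ i, min (R x i) C ≤ R x₀ i + δ ∧ min (R x₀ i) C ≤ R x i + δ := by
    intro i
    by_cases h : δ < B i
    · exact hx i h
    · rw [not_lt] at h
      exact ⟨(min_le_left _ _).trans (((hRB x i).trans h).trans le_add_self),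
        (min_le_left _ _).trans (((hRB x₀ i).trans h).trans le_add_self)⟩
  rw [PointedGHSpace.dist_mk]
  have := pghDist_bouquet_le hG i (hR x) (hR x₀) ht (fun i => (hx' i).1) (fun i => (hx' i).2)
  linarith

/-- A bouquet in which only one space has survived the truncation. -/
theorem mk_bouquet_eq (i : I) {R : I → ℝ≥0∞} (hR : ∀ ε, 0 < ε → {i | ε < R i}.Finite) {j : I}
    (hj : R j = ∞) (h0 : ∀ k, k ≠ j → R k = 0) :
    PointedGHSpace.mk (.bouquet G i R hR) = PointedGHSpace.mk (G j) := by
  symm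
  let f : (G j).carrier → trunc G R := fun y =>
    ⟨SeparationQuotient.mk ⟨j, y⟩, mk_mem_trunc (x := ⟨j, y⟩) (by simp [hj])⟩
  have hf : Isometry f := Isometry.of_dist_eq (Spoke.dist_mk_mk j)
  have hcenter : f (G j).base = truncBase G R i := by
    refine Subtype.ext (dist_eq_zero.1 ?_)
    change dist (Spoke.center G j) (Spoke.center G i) = 0
    rw [Spoke.dist_center, Spoke.radius_center]
  have hsurj : Function.Surjective f := by
    rintro ⟨_, ⟨k, y⟩, hy, rfl⟩
    by_cases hk : k = j
    · subst hk; exact ⟨y, rfl⟩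
    · refine ⟨(G j).base, ?_⟩
      rw [hcenter]
      refine Subtype.ext (dist_eq_zero.1 ?_)
      rw [dist_comm]
      change dist (⟨k, y⟩ : Spoke G) (Spoke.center G i) = 0
      rw [Spoke.dist_center]
      have : ENNReal.ofReal (Spoke.radius (⟨k, y⟩ : Spoke G)) ≤ 0 := (h0 k hk) ▸ hy
      exact le_antisymm (ENNReal.ofReal_eq_zero.1 (le_zero_iff.1 this)) (Spoke.radius_nonneg _)
  exact Quotient.sound ⟨⟨Equiv.ofBijective f ⟨hf.injective, hsurj⟩, hf⟩, hcenter⟩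

end Bouquet

/-! ### Stars at the base point -/

section Star

open scoped ENNReal

/-- There is a family, indexed by `ι`, of points at distance `s` from the base point any two of
which lie at the largest possible distance `2 * s`. In a bouquet, points on different spokes are of
this kind. -/
def PointedProperSpace.HasStar (X : PointedProperSpace.{u}) (s : ℝ) (ι : Type) : Prop :=
  ∃ F : ι → X.carrier, (∀ a, dist (F a) X.base = s) ∧ ∀ a b, a ≠ b → dist (F a) (F b) = 2 * s

theorem PointedProperSpace.HasStar.of_mk_eq {X Y : PointedProperSpace.{u}} {s : ℝ} {ι : Type}
    (h : X.HasStar s ι) (hXY : PointedGHSpace.mk X = PointedGHSpace.mk Y) : Y.HasStar s ι := by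
  obtain ⟨e, he⟩ := Quotient.exact hXY
  obtain ⟨F, hF, hF'⟩ := h
  refine ⟨fun a => e (F a), fun a => ?_, fun a b hab => ?_⟩
  · rw [← he, e.dist_eq, hF]
  · rw [e.dist_eq, hF' a b hab]

variable {I : Type} {G : I → PointedProperSpace.{u}}

theorem hasStar_bouquet {i : I} {R : I → ℝ≥0∞} {hR : ∀ ε, 0 < ε → {i | ε < R i}.Finite} {s : ℝ}
    {ι : Type} (F : ι → Spoke G) (hF : ∀ a b, (F a).idx = (F b).idx → a = b)
    (hs : ∀ a, (F a).radius = s) (hsR : ∀ a, ENNReal.ofReal s ≤ R (F a).idx) :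
    (PointedProperSpace.bouquet G i R hR).HasStar s ι := by
  refine ⟨fun a => ⟨_, Bouquet.mk_mem_trunc (x := F a) (by rw [hs]; exact hsR a)⟩,
    fun a => ?_, fun a b hab => ?_⟩
  · exact (Spoke.dist_center (F a) i).trans (hs a)
  · refine (Spoke.dist_of_ne (x := F a) (y := F b) fun h => hab (hF a b h)).trans ?_
    rw [hs, hs, two_mul]

/-- A star has at most as many points as there are sets in a cover of the sphere of radius `s` by
sets of diameter less than `2 * s`. -/
theorem card_le_of_hasStar {i : I} {R : I → ℝ≥0∞} {hR : ∀ ε, 0 < ε → {i | ε < R i}.Finite}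
    {s : ℝ} {ι : Type} {C : Type*} [Fintype ι] [Fintype C]
    (h : (PointedProperSpace.bouquet G i R hR).HasStar s ι) (U : C → Set (Spoke G))
    (hU : ∀ x : Spoke G, x.radius = s → ENNReal.ofReal s ≤ R x.idx → ∃ c, x ∈ U c)
    (hU' : ∀ c, ∀ x ∈ U c, ∀ y ∈ U c, x.radius = s → y.radius = s → dist x y < 2 * s) :
    Fintype.card ι ≤ Fintype.card C := by
  obtain ⟨F, hF, hF'⟩ := h
  have hrep : ∀ a, ∃ x : Spoke G, ENNReal.ofReal x.radius ≤ R x.idx ∧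
      SeparationQuotient.mk x = (F a).1 := fun a => (F a).2
  choose f hfR hf using hrep
  have hfs : ∀ a, (f a).radius = s := fun a => by
    have h1 : dist (F a).1 (SeparationQuotient.mk (Spoke.center G i)) = s := hF a
    rwa [← hf, SeparationQuotient.dist_mk, Spoke.dist_center] at h1
  have hfd : ∀ a b, a ≠ b → dist (f a) (f b) = 2 * s := fun a b hab => by
    have h1 : dist (F a).1 (F b).1 = 2 * s := hF' a b hab
    rwa [← hf, ← hf, SeparationQuotient.dist_mk] at h1
  choose c hc using fun a => hU (f a) (hfs a) (by rw [← hfs a]; exact hfR a)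
  refine Fintype.card_le_of_injective c fun a b hab => ?_
  by_contra hne
  have := hU' (c a) (f a) (hc a) (f b) (by rw [hab]; exact hc b) (hfs a) (hfs b)
  rw [hfd a b hne] at this
  exact lt_irrefl _ this

/-! ### Rays -/

instance : ProperSpace (ULift.{u} NNReal) where
  isCompact_closedBall x r := by
    have : Metric.closedBall x r = ULift.up '' Metric.closedBall x.down r := by
      ext y
      exact ⟨fun h => ⟨y.down, h, rfl⟩, by rintro ⟨z, hz, rfl⟩; exact hz⟩
    rw [this]
    exact (isCompact_closedBall _ _).image continuous_uliftUp

/-- The half-line `[0, ∞)` with base point `0`. -/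
def PointedProperSpace.ray : PointedProperSpace.{u} where
  carrier := ULift.{u} NNReal
  base := ⟨0⟩

theorem satisfiesBruhatTits_ray :
    SatisfiesBruhatTits PointedProperSpace.ray.{u}.carrier := by
  rintro ⟨x⟩ ⟨y⟩ t ht0 ht1
  have h : 0 ≤ (1 - t) * (x : ℝ) + t * y := by
    have := sub_nonneg.2 ht1
    positivity
  refine ⟨⟨⟨(1 - t) * (x : ℝ) + t * y, h⟩⟩, ?_⟩
  rintro ⟨z⟩
  have e : (1 - t) * (x : ℝ) + t * y = AffineMap.lineMap (x : ℝ) (y : ℝ) t := by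
    rw [AffineMap.lineMap_apply_ring]
  change dist (z : ℝ) ((1 - t) * (x : ℝ) + t * y) ^ 2 ≤
    (1 - t) * dist (z : ℝ) x ^ 2 + t * dist (z : ℝ) y ^ 2 - t * (1 - t) * dist (x : ℝ) y ^ 2
  rw [e, dist_lineMap_sq]

theorem dist_ray_base (s : NNReal) :
    dist (⟨s⟩ : PointedProperSpace.ray.{u}.carrier) PointedProperSpace.ray.{u}.base = s := by
  change dist (s : ℝ) ((0 : NNReal) : ℝ) = s
  simp

theorem ray_eq_of_dist_base_eq {x y : PointedProperSpace.ray.{u}.carrier}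
    (h : dist x PointedProperSpace.ray.{u}.base = dist y PointedProperSpace.ray.{u}.base) :
    x = y := by
  obtain ⟨x⟩ := x
  obtain ⟨y⟩ := y
  have h' : (x : ℝ) = y := (dist_ray_base.{u} x).symm.trans (h.trans (dist_ray_base.{u} y))
  exact congrArg _ (NNReal.coe_injective h')

/-! ### Reading off the lengths of segments -/

variable {J : Type}

/-- Finitely many given spaces `X j`, together with `m k` rays for every `k`. -/
def withRays (X : J → PointedProperSpace.{u}) (m : ℕ → ℕ) :
    J ⊕ (Σ k, Fin (m k)) → PointedProperSpace.{u} :=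
  Sum.elim X fun _ => .ray

theorem satisfiesBruhatTits_withRays {X : J → PointedProperSpace.{u}}
    (hX : ∀ j, SatisfiesBruhatTits (X j).carrier) (m : ℕ → ℕ) (i : J ⊕ (Σ k, Fin (m k))) :
    SatisfiesBruhatTits (withRays X m i).carrier := by
  rcases i with j | i
  · exact hX j
  · exact satisfiesBruhatTits_ray

/-- The radii at which the spokes of `withRays X m` are truncated: `r j` for the space `X j`, and
`ℓ k` for each of the `m k` rays with number `k`. -/
noncomputable def radii (m : ℕ → ℕ) (r : J → ℝ≥0∞) (ℓ : ℕ → ℝ) :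
    J ⊕ (Σ k, Fin (m k)) → ℝ≥0∞ :=
  Sum.elim r fun x => ENNReal.ofReal (ℓ x.1)

theorem finite_lt_radii [Finite J] (m : ℕ → ℕ) (r : J → ℝ≥0∞) {ℓ : ℕ → ℝ}
    (hℓ : ∀ k, ℓ k ≤ 2 * (1 / 3) ^ k) (ε : ℝ≥0∞) (hε : 0 < ε) :
    {i | ε < radii m r ℓ i}.Finite := by
  have ht : Tendsto (fun k : ℕ => ENNReal.ofReal (2 * (1 / 3) ^ k)) atTop (𝓝 0) := by
    rw [← ENNReal.ofReal_zero]
    refine ENNReal.tendsto_ofReal ?_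
    simpa using (tendsto_pow_atTop_nhds_zero_of_lt_one (r := (1 / 3 : ℝ)) (by norm_num)
      (by norm_num)).const_mul 2
  obtain ⟨N, hN⟩ := eventually_atTop.1 (ht.eventually_lt_const hε)
  let e : J ⊕ (Σ k : Fin N, Fin (m k)) → J ⊕ (Σ k, Fin (m k)) :=
    Sum.map id fun x => ⟨x.1, x.2⟩
  refine (Set.finite_range e).subset ?_
  rintro (j | ⟨k, a⟩) hi
  · exact ⟨Sum.inl j, rfl⟩
  · have hk : k < N := by
      by_contra! h
      exact lt_irrefl ε
        ((hi.trans_le (ENNReal.ofReal_le_ofReal (hℓ k))).trans (hN k h))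
    exact ⟨Sum.inr ⟨⟨k, hk⟩, a⟩, rfl⟩

/-- The multiplicities `m` can be chosen so large, in terms of covering numbers of balls in the
spaces `X j`, that stars of `∑ j ≤ k, m j` points detect the length `ℓ k`: at the scale
`[3⁻ᵏ, 2 * 3⁻ᵏ]` all the rays with number less than `k` and none with larger number are present,
and the contribution of all the spaces `X j` together is less than `m k`. -/
theorem exists_multiplicities [Fintype J] (X : J → PointedProperSpace.{u}) :
    ∃ m : ℕ → ℕ, ∀ (r : J → ℝ≥0∞) (ℓ : ℕ → ℝ) (hℓ : ∀ k, ℓ k ≤ 2 * (1 / 3) ^ k)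
      (i : J ⊕ (Σ k, Fin (m k))) (k : ℕ) (s : ℝ), (1 / 3) ^ k ≤ s → s ≤ 2 * (1 / 3) ^ k →
      (s ≤ ℓ k → ∀ l ≤ k, s ≤ ℓ l) →
      ((PointedProperSpace.bouquet (withRays X m) i (radii m r ℓ)
        (finite_lt_radii m r hℓ)).HasStar s (Σ l : Fin (k + 1), Fin (m l)) ↔ s ≤ ℓ k) := by
  have hnet : ∀ (j : J) (k : ℕ), ∃ t : Finset (X j).carrier,
      Metric.closedBall (X j).base 2 ⊆ ⋃ y ∈ t, Metric.ball y ((1 / 3 : ℝ) ^ k) := fun j k => by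
    obtain ⟨t, ht, ht'⟩ := Metric.totallyBounded_iff.1
      (isCompact_closedBall (X j).base 2).totallyBounded ((1 / 3 : ℝ) ^ k) (by positivity)
    refine ⟨ht.toFinset, by simpa using ht'⟩
  choose net hnet using hnet
  obtain ⟨m, hm⟩ : ∃ m : ℕ → ℕ, ∀ k, ∑ j, (net j k).card < m k :=
    ⟨fun k => ∑ j, (net j k).card + 1, fun k => Nat.lt_succ_self _⟩
  refine ⟨m, fun r ℓ hℓ i k s hs hs' hmono =>
    ⟨fun h => ?_, fun h => ?_⟩⟩
  · by_contra! hlt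
    have hpow : (0 : ℝ) < (1 / 3) ^ k := by positivity
    have hs0 : 0 < s := hpow.trans_le hs
    have hpow1 : ((1 : ℝ) / 3) ^ k ≤ 1 := pow_le_one₀ (by norm_num) (by norm_num)
    let U : (Σ l : Fin k, Fin (m l)) ⊕ (Σ j, net j k) → Set (Spoke (withRays X m)) :=
      Sum.elim (fun c => {x | x.idx = Sum.inr ⟨c.1, c.2⟩})
        (fun c => Spoke.mk (G := withRays X m) (Sum.inl c.1) ''
          Metric.ball (c.2 : (X c.1).carrier) ((1 / 3 : ℝ) ^ k))
    have hcard := card_le_of_hasStar h U ?_ ?_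
    · simp only [Fintype.card_sigma, Fintype.card_sum, Fintype.card_fin, Fintype.card_coe,
        Fin.sum_univ_castSucc, Fin.val_castSucc, Fin.val_last] at hcard
      have := hm k
      omega
    · rintro ⟨j | ⟨l, a⟩, y⟩ hy hyR
      · have hs2 : s ≤ 2 := by linarith
        have hy2 : y ∈ Metric.closedBall (X j).base 2 := (le_of_eq hy).trans hs2
        obtain ⟨c, hc, hyc⟩ := Set.mem_iUnion₂.1 (hnet j k hy2)
        exact ⟨Sum.inr ⟨j, c, hc⟩, y, hyc, rfl⟩
      · have hsl : s ≤ ℓ l := by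
          have h1 : ENNReal.ofReal s ≤ ENNReal.ofReal (ℓ l) := hyR
          rw [ENNReal.ofReal_le_ofReal_iff'] at h1
          exact h1.resolve_right (not_le.2 hs0)
        have hl : l < k := by
          by_contra! hkl
          rcases hkl.eq_or_lt with rfl | hkl
          · exact absurd hsl (not_le.2 hlt)
          · have h1 : ((1 : ℝ) / 3) ^ l ≤ (1 / 3) ^ (k + 1) :=
              pow_le_pow_of_le_one (by norm_num) (by norm_num) hkl
            rw [pow_succ] at h1
            linarith [hℓ l]
        exact ⟨Sum.inl ⟨⟨l, hl⟩, a⟩, rfl⟩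
    · rintro (c | c) x hx y hy hxs hys
      · obtain ⟨ix, x⟩ := x
        obtain ⟨iy, y⟩ := y
        obtain rfl : ix = _ := hx
        obtain rfl : iy = _ := hy
        have hxy : x = y := ray_eq_of_dist_base_eq (hxs.trans hys.symm)
        rw [hxy, dist_self]
        linarith
      · obtain ⟨x, hx, rfl⟩ := hx
        obtain ⟨y, hy, rfl⟩ := hy
        rw [Spoke.dist_mk_mk]
        have h1 := dist_triangle_right x y c.2.1
        have h2 := Metric.mem_ball.1 hx
        have h3 := Metric.mem_ball.1 hy
        exact h1.trans_lt (by linarith)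
  · have hs0 : 0 ≤ s := le_trans (by positivity) hs
    refine hasStar_bouquet (fun a => ⟨Sum.inr ⟨a.1, a.2⟩, (⟨⟨s, hs0⟩⟩ : ULift.{u} NNReal)⟩) ?_ ?_ ?_
    · rintro ⟨l, a⟩ ⟨l', a'⟩ hab
      simp only [Sum.inr.injEq, Sigma.mk.injEq, Fin.val_inj] at hab
      obtain ⟨rfl, h2⟩ := hab
      rw [eq_of_heq h2]
    · exact fun a => dist_ray_base.{u} ⟨s, hs0⟩
    · intro a
      exact ENNReal.ofReal_le_ofReal (hmono h a.1 (Nat.lt_succ_iff.1 a.1.2))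

end Star

/-! ### Coordinates on a compact metrizable space -/

section Coordinates

/-- The functions `min 1 (dist · x)`, for `x` in a dense sequence in which every point is repeated
infinitely often. -/
theorem exists_separating_seq (H : Type v) [MetricSpace H] [CompactSpace H] [Nonempty H] :
    ∃ c : ℕ → H → ℝ, (∀ k, Continuous (c k)) ∧ (∀ k x, 0 ≤ c k x) ∧ (∀ k x, c k x ≤ 1) ∧
      ∀ x y K, (∀ k, K ≤ k → c k x = c k y) → x = y := by
  refine ⟨fun k x => min 1 (dist x (TopologicalSpace.denseSeq H k.unpair.1)),
    fun k => by fun_prop, fun k x => by positivity, fun k x => min_le_left _ _,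
    fun x y K h => ?_⟩
  refine eq_of_forall_dist_le fun ε hε => ?_
  obtain ⟨j, hj⟩ := (TopologicalSpace.denseRange_denseSeq H).exists_dist_lt x
    (lt_min one_pos (half_pos hε))
  have h1 := h (Nat.pair j K) (Nat.right_le_pair j K)
  simp only [Nat.unpair_pair] at h1
  set w := TopologicalSpace.denseSeq H j
  have h2 : dist x w < 1 := hj.trans_le (min_le_left _ _)
  have h3 : dist x w < ε / 2 := hj.trans_le (min_le_right _ _)
  rw [min_eq_right h2.le] at h1
  have h4 : dist y w = dist x w := by
    rcases min_choice 1 (dist y w) with h5 | h5 <;> rw [h5] at h1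
    · exact absurd h1 h2.ne
    · exact h1.symm
  linarith [dist_triangle_right x y w]

end Coordinates

/-! ### The embedding -/

section Embedding

open scoped ENNReal

/-- The core of the construction, for representatives `X j` and a metric on `H`. At the point
`p j`, the truncation radius of `X j` is `∞` and all other radii vanish; the lengths `ℓ k` of the
segments at a point outside the range of `p` are bounded by the distance from this range, but from
some `k` on they are `3⁻ᵏ * (1 + c k)`. -/
theorem exists_continuous_injective {J : Type} [Fintype J] [Nonempty J] {H : Type v}
    [MetricSpace H] [CompactSpace H] (p : J → H) (hp : Function.Injective p)
    (X : J → PointedProperSpace.{u}) (hX : ∀ j, SatisfiesBruhatTits (X j).carrier)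
    (hX' : ∀ i j, PointedGHSpace.mk (X i) = PointedGHSpace.mk (X j) → i = j) :
    ∃ Y : H → PointedProperSpace.{u}, (∀ x, SatisfiesBruhatTits (Y x).carrier) ∧
      Continuous (fun x => PointedGHSpace.mk (Y x)) ∧
      Function.Injective (fun x => PointedGHSpace.mk (Y x)) ∧
      ∀ j, PointedGHSpace.mk (Y (p j)) = PointedGHSpace.mk (X j) := by
  obtain ⟨m, hm⟩ := exists_multiplicities X
  let j₀ : J := Classical.arbitrary J
  have : Nonempty H := ⟨p j₀⟩
  obtain ⟨c, hc, hc0, hc1, hsep⟩ := exists_separating_seq H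
  obtain ⟨δ, hδ, hpδ⟩ : ∃ δ : ℝ, 0 < δ ∧ ∀ i j, i ≠ j → δ ≤ dist (p i) (p j) := by
    have : ∀ᶠ δ : ℝ in 𝓝[>] 0, ∀ i j, i ≠ j → δ ≤ dist (p i) (p j) := by
      refine eventually_all.2 fun i => eventually_all.2 fun j => ?_
      by_cases hij : i = j
      · simp [hij]
      · filter_upwards [nhdsWithin_le_nhds
          (eventually_le_nhds (dist_pos.2 (hp.ne hij)))] with δ hδ _ using hδ
    obtain ⟨δ, hδ, hδ'⟩ := (this.and self_mem_nhdsWithin).exists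
    exact ⟨δ, hδ', hδ⟩
  set V := Set.range p
  have hVc : IsClosed V := (Set.finite_range p).isClosed
  have hVne : V.Nonempty := Set.range_nonempty p
  let r : H → J → ℝ≥0∞ := fun x j => (ENNReal.ofReal (dist x (p j) / δ))⁻¹ - 1
  let ℓ : H → ℕ → ℝ := fun x k => min (Metric.infDist x V) ((1 / 3) ^ k * (1 + c k x))
  have hℓ : ∀ x k, ℓ x k ≤ 2 * (1 / 3) ^ k := fun x k => by
    refine (min_le_right _ _).trans ?_
    have : (0 : ℝ) < (1 / 3) ^ k := by positivity
    nlinarith [hc1 k x]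
  have hr_self : ∀ j, r (p j) j = ∞ := fun j => by simp [r]
  have hr_ne : ∀ i j, j ≠ i → r (p i) j = 0 := fun i j hij => by
    refine tsub_eq_zero_of_le (ENNReal.inv_le_one.2 ?_)
    rw [ENNReal.one_le_ofReal, one_le_div hδ]
    exact hpδ i j (Ne.symm hij)
  have hℓ_p : ∀ j k, ℓ (p j) k = 0 := fun j k => by
    have h1 : Metric.infDist (p j) V = 0 := Metric.infDist_zero_of_mem ⟨j, rfl⟩
    have h2 : (0 : ℝ) ≤ (1 / 3) ^ k * (1 + c k (p j)) :=
      mul_nonneg (by positivity) (by linarith [hc0 k (p j)])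
    simp only [ℓ, h1, min_eq_left h2]
  let Y : H → PointedProperSpace.{u} := fun x =>
    .bouquet (withRays X m) (Sum.inl j₀) (radii m (r x) (ℓ x)) (finite_lt_radii m _ (hℓ x))
  have hG := satisfiesBruhatTits_withRays hX m
  have hYp : ∀ j, PointedGHSpace.mk (Y (p j)) = PointedGHSpace.mk (X j) := fun j => by
    refine mk_bouquet_eq (G := withRays X m) (j := Sum.inl j) _ _ (hr_self j) ?_
    rintro (i | i) hi
    · exact hr_ne j i fun h => hi (congrArg _ h)
    · exact ENNReal.ofReal_eq_zero.2 (hℓ_p j i.1).le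
  -- The class of `Y x` determines the lengths `ℓ x k` at the scale `3⁻ᵏ`.
  have hstar : ∀ x y, PointedGHSpace.mk (Y x) = PointedGHSpace.mk (Y y) →
      ∀ k s, (1 / 3) ^ k ≤ s → s ≤ 2 * (1 / 3) ^ k → s ≤ ℓ x k → s ≤ ℓ y k := by
    intro x y hxy k s hs hs' hsx
    have hmono : ∀ z, s ≤ ℓ z k → ∀ l ≤ k, s ≤ ℓ z l := fun z hz l hl => by
      rcases hl.eq_or_lt with rfl | hl
      · exact hz
      refine le_min (hz.trans (min_le_left _ _)) ?_
      have h1 : ((1 : ℝ) / 3) ^ k ≤ (1 / 3) ^ (l + 1) :=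
        pow_le_pow_of_le_one (by norm_num) (by norm_num) hl
      rw [pow_succ] at h1
      have h2 : (0 : ℝ) < (1 / 3) ^ l := by positivity
      nlinarith [hc0 l z]
    exact (hm (r y) (ℓ y) (hℓ y) _ k s hs hs' (hmono y)).1
      (((hm (r x) (ℓ x) (hℓ x) _ k s hs hs' (hmono x)).2 hsx).of_mk_eq hxy)
  -- Outside the range of `p`, all but finitely many lengths carry the full information.
  have hlarge : ∀ x, 0 < Metric.infDist x V → ∃ K, ∀ k, K ≤ k →
      ℓ x k = (1 / 3) ^ k * (1 + c k x) := fun x hx => by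
    have ht : Tendsto (fun k : ℕ => 2 * ((1 : ℝ) / 3) ^ k) atTop (𝓝 0) := by
      simpa using (tendsto_pow_atTop_nhds_zero_of_lt_one (r := (1 / 3 : ℝ)) (by norm_num)
        (by norm_num)).const_mul 2
    obtain ⟨K, hK⟩ := eventually_atTop.1 (ht.eventually_lt_const hx)
    refine ⟨K, fun k hk => min_eq_right ?_⟩
    have : (0 : ℝ) < (1 / 3) ^ k := by positivity
    nlinarith [hK k hk, hc1 k x]
  have hpow_le : ∀ x k, ((1 : ℝ) / 3) ^ k ≤ (1 / 3) ^ k * (1 + c k x) := fun x k => by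
    have : (0 : ℝ) < (1 / 3) ^ k := by positivity
    nlinarith [hc0 k x]
  have hpos : ∀ x y, PointedGHSpace.mk (Y x) = PointedGHSpace.mk (Y y) →
      0 < Metric.infDist x V → 0 < Metric.infDist y V := by
    intro x y hxy hx
    obtain ⟨K, hK⟩ := hlarge x hx
    have h0 : (0 : ℝ) < (1 / 3) ^ K := by positivity
    have h1 := hstar x y hxy K ((1 / 3) ^ K) le_rfl (by linarith)
      ((hpow_le x K).trans (hK K le_rfl).ge)
    exact h0.trans_le (h1.trans (min_le_left _ _))
  refine ⟨Y, fun x => Bouquet.satisfiesBruhatTits_trunc hG _, ?_, ?_, hYp⟩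
  · refine continuous_mk_bouquet (fun i => (hG i).isGeodesicMetricSpace) _
      (B := radii m (fun _ => ∞) fun k => 2 * (1 / 3) ^ k)
      (finite_lt_radii m _ fun k => le_rfl) ?_ _ ?_
    · rintro x (j | i)
      · exact le_top
      · exact ENNReal.ofReal_le_ofReal (hℓ x i.1)
    · rintro (j | i)
      · refine (ENNReal.continuous_sub_right 1).comp (continuous_inv.comp ?_)
        exact ENNReal.continuous_ofReal.comp (by fun_prop)
      · refine ENNReal.continuous_ofReal.comp ?_
        have := hc i.1
        have := Metric.continuous_infDist_pt V
        fun_prop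
  · intro x y hxy
    rcases (Metric.infDist_nonneg (x := x) (s := V)).eq_or_lt' with hx | hx
    · have hy : Metric.infDist y V = 0 := by
        by_contra hy
        exact (hpos y x hxy.symm (lt_of_le_of_ne Metric.infDist_nonneg (Ne.symm hy))).ne' hx
      obtain ⟨i, rfl⟩ := (hVc.mem_iff_infDist_zero hVne).2 hx
      obtain ⟨j, rfl⟩ := (hVc.mem_iff_infDist_zero hVne).2 hy
      rw [hX' i j ((hYp i).symm.trans (Eq.trans hxy (hYp j)))]
    · obtain ⟨K, hK⟩ := hlarge x hx
      obtain ⟨L, hL⟩ := hlarge y (hpos x y hxy hx)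
      refine hsep x y (max K L) fun k hk => ?_
      have hKk := hK k ((le_max_left _ _).trans hk)
      have hLk := hL k ((le_max_right _ _).trans hk)
      have h1 := hstar x y hxy k (ℓ x k) (hKk ▸ hpow_le x k) (hℓ x k) le_rfl
      have h2 := hstar y x hxy.symm k (ℓ y k) (hLk ▸ hpow_le y k) (hℓ y k) le_rfl
      have h3 := le_antisymm h1 h2
      rw [hKk, hLk] at h3
      have h4 : (1 / 3 : ℝ) ^ k ≠ 0 := by positivity
      exact add_left_cancel (mul_left_cancel₀ h4 h3)

end Embedding

theorem theorem1p4 (n : ℕ) (hn : 1 ≤ n)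
    {H : Type v} [TopologicalSpace H] [CompactSpace H] [TopologicalSpace.MetrizableSpace H]
    (p : Fin (n + 1) → H) (hp : Function.Injective p)
    (X : Fin (n + 1) → PointedGHSpace.catZero.{u})
    (hX : ∀ i j, i ≠ j → 0 < dist (X i) (X j)) :
    ∃ Φ : H → PointedGHSpace.catZero.{u}, IsEmbedding Φ ∧ ∀ i, Φ (p i) = X i := by
  let := TopologicalSpace.metrizableSpaceMetric H
  choose Z hZ hZX using fun i => (X i).2
  obtain ⟨Y, hY, hcont, hinj, hYp⟩ := exists_continuous_injective p hp Z
    (fun i => (hZ i).satisfiesBruhatTits) (fun i j h => by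
      by_contra hij
      rw [hZX, hZX] at h
      exact (hX i j hij).ne' (dist_eq_zero.2 (Subtype.ext h)))
  refine ⟨fun x => ⟨PointedGHSpace.mk (Y x), Y x, (hY x).isCATZero, rfl⟩, ?_, fun i => ?_⟩
  · exact (Continuous.isClosedEmbedding (hcont.subtype_mk _)
      fun x y h => hinj (congrArg Subtype.val h)).isEmbedding
  · exact Subtype.ext ((hYp i).trans (hZX i))
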